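/- Let $d\ge 1$. There is a constant $a>0$, depending only on $d$, such that the following holds for every box $\Lambda=\prod_{i=1}^d\{0,\dots,L_i-1\}$ of the $d$-dimensional square lattice with open boundary conditions (two sites are neighbours if they differ by exactly one in exactly one coordinate), with $n=\prod_i L_i\ge 2$ sites and a qubit at every site; in particular for the cube $L_1=\dots=L_d$. Let $p$ be the law of the random unitary $U$ on $n$ qubits given by one step of the sequential random quantum circuit on $\Lambda$: a pair of nearest neighbours is drawn uniformly at random, and a random two-qubit gate, distributed either according to the Haar measure on $U(4)$ or uniformly on the two-qubit Clifford group (up to global phases), is applied to the two qubits. Let $M$ be the second-moment operator, the linear map on the operators on two copies of $(\mathbb C^2)^{\otimes n}$ given by $M[Z]=\mathbb E_{U\sim p}\,(U\otimes U)\,Z\,(U\otimes U)^\dagger$, that is $M[X\otimes Y]=\mathbb E_{U\sim p}\,UXU^\dagger\otimes UYU^\dagger$. Then the eigenspace of $M$ for the eigenvalue $1$ is the span of the identity and of the swap of the two copies, and the spectral gap $$\Delta = 1-\max\{|\lambda| : \lambda \text{ an eigenvalue of } M,\ \lambda\neq 1\}$$ satisfies $\Delta\ge \dfrac{a}{n}$.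 -/

import Mathlib

open MeasureTheory
open scoped Kronecker NNReal

noncomputable section

/-! ### The unitary group as a compact topological group with its Borel sets -/

instance unitaryMeasurableSpace {q : Type*} [Fintype q] [DecidableEq q] :
    MeasurableSpace (Matrix.unitaryGroup q ℂ) := borel _

instance unitaryBorelSpace {q : Type*} [Fintype q] [DecidableEq q] :
    BorelSpace (Matrix.unitaryGroup q ℂ) := ⟨rfl⟩

instance unitaryCompactSpace {q : Type*} [Fintype q] [DecidableEq q] :
    CompactSpace (Matrix.unitaryGroup q ℂ) := by
  refine isCompact_iff_compactSpace.mp ?_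
  have hK : IsCompact (Set.univ.pi fun _ : q => Set.univ.pi fun _ : q =>
      Metric.closedBall (0 : ℂ) 1) :=
    isCompact_univ_pi fun _ => isCompact_univ_pi fun _ => isCompact_closedBall _ _
  refine IsCompact.of_isClosed_subset (X := Matrix q q ℂ) hK ?_ ?_
  · have h : {U : Matrix q q ℂ | U ∈ Matrix.unitaryGroup q ℂ} =
        {U : Matrix q q ℂ | U * star U = 1} := by
      ext U; exact Matrix.mem_unitaryGroup_iff
    change IsClosed {U : Matrix q q ℂ | U ∈ Matrix.unitaryGroup q ℂ}
    rw [h]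
    exact isClosed_eq (by fun_prop) continuous_const
  · intro U hU i _ j _
    simpa using entry_norm_bound_of_unitary hU i j

/-! ### Second-moment operators of measures on the unitary group -/

/-- The second-moment operator of a (finite, in practice probability) measure `p` on the unitary
group of `ℂ^q`: the linear map `Z ↦ ∫ (U ⊗ U) Z (U ⊗ U)† dp(U)` on the operators on two copies
of `ℂ^q`, the integral being taken entrywise.  On product operators it reads
`X ⊗ Y ↦ ∫ U X U† ⊗ U Y U† dp(U)`. -/
def secondMoment {q : Type*} [Fintype q] [DecidableEq q]
    (p : Measure (Matrix.unitaryGroup q ℂ)) [IsFiniteMeasure p] :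
    Module.End ℂ (Matrix (q × q) (q × q) ℂ) :=
  have hint : ∀ (Z : Matrix (q × q) (q × q) ℂ) (a b : q × q), Integrable
      (fun U : Matrix.unitaryGroup q ℂ =>
        ((U.1 ⊗ₖ U.1) * Z * (U.1 ⊗ₖ U.1).conjTranspose) a b) p := by
    intro Z a b
    have hc : Continuous (fun U : Matrix.unitaryGroup q ℂ =>
        ((U.1 ⊗ₖ U.1) * Z * (U.1 ⊗ₖ U.1).conjTranspose) a b) := by
      have hk : Continuous (fun U : Matrix.unitaryGroup q ℂ => U.1 ⊗ₖ U.1) := by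
        refine continuous_matrix fun i j => ?_
        have h : ∀ i j : q, Continuous (fun U : Matrix.unitaryGroup q ℂ => U.1 i j) :=
          fun i j => continuous_subtype_val.matrix_elem i j
        exact (h _ _).mul (h _ _)
      exact ((hk.matrix_mul continuous_const).matrix_mul hk.matrix_conjTranspose).matrix_elem a b
    exact integrableOn_univ.mp (hc.continuousOn.integrableOn_compact isCompact_univ)
  { toFun := fun Z => Matrix.of fun a b =>
      ∫ U : Matrix.unitaryGroup q ℂ, ((U.1 ⊗ₖ U.1) * Z * (U.1 ⊗ₖ U.1).conjTranspose) a b ∂p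
    map_add' := fun Z W => by
      ext a b
      simp only [Matrix.of_apply, Matrix.add_apply, Matrix.mul_add, Matrix.add_mul]
      exact integral_add (hint Z a b) (hint W a b)
    map_smul' := fun c Z => by
      ext a b
      simp only [Matrix.of_apply, Matrix.smul_apply, Matrix.mul_smul, Matrix.smul_mul,
        RingHom.id_apply]
      exact integral_smul c _ }

/-- The swap operator on two copies of `ℂ^q`. -/
def swapOp (q : Type*) [DecidableEq q] : Matrix (q × q) (q × q) ℂ :=
  Matrix.of fun a b => if a.1 = b.2 ∧ a.2 = b.1 then 1 else 0

/-- The spectral gap `1 - λ₂`, where `λ₂` is the largest absolute value of the eigenvalues of `T`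
other than the eigenvalue `1`. -/
def spectralGap {W : Type*} [AddCommGroup W] [Module ℂ W] (T : Module.End ℂ W) : ℝ :=
  1 - sSup {r : ℝ | ∃ z : ℂ, T.HasEigenvalue z ∧ z ≠ 1 ∧ r = ‖z‖}

/-! ### Random two-qubit gates -/

/-- The Haar probability measure on the unitary group `U(4)` of two qubits. -/
def haarGate : Measure (Matrix.unitaryGroup (Fin 2 × Fin 2) ℂ) := Measure.haarMeasure ⊤

/-- The Pauli matrices `1, X, Y, Z`. -/
def pauli : Fin 4 → Matrix (Fin 2) (Fin 2) ℂ :=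
  ![1, !![0, 1; 1, 0], !![0, -Complex.I; Complex.I, 0], !![1, 0; 0, -1]]

/-- The (elements of the) two-qubit Pauli group `{iᵏ σ_a ⊗ σ_b}`. -/
def pauliGroup₂ : Set (Matrix (Fin 2 × Fin 2) (Fin 2 × Fin 2) ℂ) :=
  Set.range fun x : Fin 4 × Fin 4 × Fin 4 =>
    Complex.I ^ (x.1 : ℕ) • (pauli x.2.1 ⊗ₖ pauli x.2.2)

/-- The two-qubit Clifford group: the unitaries that normalize the Pauli group. -/
def cliffordGroup₂ : Subgroup (Matrix.unitaryGroup (Fin 2 × Fin 2) ℂ) where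
  carrier := {U | ∀ A ∈ pauliGroup₂, U.1 * A * star U.1 ∈ pauliGroup₂ ∧
    star U.1 * A * U.1 ∈ pauliGroup₂}
  one_mem' := by
    intro A hA
    simpa using hA
  mul_mem' := by
    intro U V hU hV A hA
    constructor
    · have h := (hU _ (hV A hA).1).1
      simpa [Matrix.mul_assoc] using h
    · have h := (hV _ (hU A hA).2).2
      simpa [Matrix.mul_assoc] using h
  inv_mem' := by
    intro U hU A hA
    have h := hU A hA
    refine ⟨?_, ?_⟩
    · simpa using h.2
    · simpa using h.1

instance cliffordCompactSpace : CompactSpace cliffordGroup₂ := by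
  refine isCompact_iff_compactSpace.mp ?_
  refine IsClosed.isCompact (X := Matrix.unitaryGroup (Fin 2 × Fin 2) ℂ) ?_
  have hfin : IsClosed pauliGroup₂ := (Set.finite_range _).isClosed
  have h : (cliffordGroup₂ : Set (Matrix.unitaryGroup (Fin 2 × Fin 2) ℂ)) =
      ⋂ A ∈ pauliGroup₂, {U | U.1 * A * star U.1 ∈ pauliGroup₂} ∩
        {U | star U.1 * A * U.1 ∈ pauliGroup₂} := by
    ext U
    simp [cliffordGroup₂]
  rw [h]
  refine isClosed_biInter fun A _ => ?_
  exact (hfin.preimage (by fun_prop)).inter (hfin.preimage (by fun_prop))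

/-- The uniform distribution on the two-qubit Clifford group, viewed as a measure on `U(4)`.
As `cliffordGroup₂` contains all global phases, it is compact but infinite, and its uniform
distribution is its Haar probability measure; modulo global phases, which do not affect the
conjugations by `U`, this is the uniform distribution on the finite group of Clifford gates. -/
def cliffordGate : Measure (Matrix.unitaryGroup (Fin 2 × Fin 2) ℂ) :=
  (Measure.haarMeasure (⊤ : TopologicalSpace.PositiveCompacts cliffordGroup₂)).map Subtype.val

/-! ### Sequential random circuits on an interaction graph, with a qubit at every vertex -/

/-- The coordinates of a computational basis state, split into those of the qubits `i`, `j` and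
those of the other qubits. -/
def splitPair {V : Type*} (i j : V) (x : V → Fin 2) :
    (Fin 2 × Fin 2) × ({k : V // k ≠ i ∧ k ≠ j} → Fin 2) :=
  ((x i, x j), fun k => x k)

theorem splitPair_bijective {V : Type*} [DecidableEq V] {i j : V} (h : i ≠ j) :
    Function.Bijective (splitPair i j) := by
  constructor
  · intro x y hxy
    simp only [splitPair, Prod.mk.injEq] at hxy
    funext k
    by_cases hi : k = i
    · rw [hi]; exact hxy.1.1
    by_cases hj : k = j
    · rw [hj]; exact hxy.1.2
    exact congrFun hxy.2 ⟨k, hi, hj⟩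
  · rintro ⟨⟨a, b⟩, f⟩
    refine ⟨fun k => if hi : k = i then a else if hj : k = j then b else f ⟨k, hi, hj⟩, ?_⟩
    simp only [splitPair, Prod.mk.injEq]
    refine ⟨⟨by simp, by simp [h.symm]⟩, ?_⟩
    funext k
    simp [k.2.1, k.2.2]

/-- The two-qubit gate `u`, applied to the qubits `i` and `j` (in this order) of a register with a
qubit at every element of `V`: the unitary `u ⊗ 1`. -/
def onPair {V : Type*} [Fintype V] [DecidableEq V] {i j : V} (h : i ≠ j)
    (u : Matrix.unitaryGroup (Fin 2 × Fin 2) ℂ) : Matrix.unitaryGroup (V → Fin 2) ℂ :=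
  ⟨(u.1 ⊗ₖ (1 : Matrix ({k : V // k ≠ i ∧ k ≠ j} → Fin 2) _ ℂ)).submatrix
      (splitPair i j) (splitPair i j), by
    have hu : u.1 * u.1.conjTranspose = 1 := Matrix.mem_unitaryGroup_iff.mp u.2
    rw [Matrix.mem_unitaryGroup_iff, Matrix.star_eq_conjTranspose, Matrix.conjTranspose_submatrix,
      ← Matrix.submatrix_mul _ _ _ _ _ (splitPair_bijective h), Matrix.conjTranspose_kronecker,
      ← Matrix.mul_kronecker_mul, hu, Matrix.conjTranspose_one, Matrix.one_mul,
      Matrix.one_kronecker_one, Matrix.submatrix_one _ (splitPair_bijective h).injective]⟩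

/-- One step of the sequential random circuit on the interaction graph `G` with gate distribution
`ν`: the law of the unitary obtained by drawing uniformly a pair of adjacent vertices and applying
a `ν`-random gate to the qubits there.  The pairs are ordered ones (darts): every edge is drawn
with the same probability, and then one of its two orientations. -/
def circuitStep {V : Type*} [Fintype V] [DecidableEq V] (G : SimpleGraph V) [DecidableRel G.Adj]
    (ν : Measure (Matrix.unitaryGroup (Fin 2 × Fin 2) ℂ)) :
    Measure (Matrix.unitaryGroup (V → Fin 2) ℂ) :=
  (Fintype.card G.Dart : ℝ≥0)⁻¹ • ∑ e : G.Dart, ν.map (onPair e.adj.ne)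

/-- The box with side lengths `L i` of the `d`-dimensional square lattice, with open boundary
conditions: two sites are adjacent if they differ by one in exactly one coordinate. -/
def latticeBox {d : ℕ} (L : Fin d → ℕ) : SimpleGraph ((i : Fin d) → Fin (L i)) where
  Adj x y := ∃ i, (SimpleGraph.pathGraph (L i)).Adj (x i) (y i) ∧ ∀ j, j ≠ i → x j = y j
  symm := ⟨fun _ _ ⟨i, h, h'⟩ => ⟨i, h.symm, fun j hj => (h' j hj).symm⟩⟩
  loopless := ⟨fun _ ⟨_, h, _⟩ => h.ne rfl⟩

instance latticeBoxDecidable {d : ℕ} (L : Fin d → ℕ) : DecidableRel (latticeBox L).Adj :=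
  fun _ _ => Classical.propDecidable _

instance haarGate_isProbabilityMeasure : IsProbabilityMeasure haarGate :=
  ⟨by
    have := Measure.haarMeasure_self
      (K₀ := (⊤ : TopologicalSpace.PositiveCompacts (Matrix.unitaryGroup (Fin 2 × Fin 2) ℂ)))
    simpa [haarGate] using this⟩

instance cliffordGate_isProbabilityMeasure : IsProbabilityMeasure cliffordGate := by
  have : IsProbabilityMeasure
      (Measure.haarMeasure (⊤ : TopologicalSpace.PositiveCompacts cliffordGroup₂)) := ⟨by
    have := Measure.haarMeasure_self
      (K₀ := (⊤ : TopologicalSpace.PositiveCompacts cliffordGroup₂))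
    simpa using this⟩
  exact Measure.isProbabilityMeasure_map measurable_subtype_coe.aemeasurable

instance circuitStep_isFiniteMeasure {V : Type*} [Fintype V] [DecidableEq V] (G : SimpleGraph V)
    [DecidableRel G.Adj] (ν : Measure (Matrix.unitaryGroup (Fin 2 × Fin 2) ℂ))
    [IsFiniteMeasure ν] : IsFiniteMeasure (circuitStep G ν) := by
  unfold circuitStep
  infer_instance

end

/-! ### Spectral gap of an average of orthogonal projections containing a chain. -/

section Hilbert

variable {E : Type*} [NormedAddCommGroup E] [InnerProductSpace ℂ E]

/-! Read operators on two copies of the register as vectors in a tensor product with one factor per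
site. Both gate laws are probability measures invariant under left multiplication by Clifford gates.
This forces the second moment of a single gate to be the orthogonal projection `pairProj` onto the
span of identity and swap on its two sites (`pairEntry_secondMoment`): the image commutes with every
`C ⊗ C`, hence is a combination of identity and swap (`clifford_commutant`), and its coefficients
are fixed by the conserved traces against these two operators. So `M` is the average of the
`pairProj` over the darts (`toTensor_secondMoment_circuitStep`).

A box has a snake, a path through all sites along edges (`exists_path_through_latticeBox`). A vector
fixed by the projections along the snake is already a combination of the global identity and swap
(`mem_span_globalState`), and these are fixed by all darts. This gives the eigenspace.

For the gap, let `H` be the sum of `1 - P` over the edges of the snake. In `H²`, disjoint edges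
commute and contribute nonnegatively. For two consecutive edges, `P Q P` equals 1 on the common
range and at most 4/25 off it (`pairProj_three_site`), so the two projections meet at an angle of
cosine at most 2/5, and the anticommutator of `1 - P` and `1 - Q` is at least -2/5 times their sum
(`neg_le_two_mul_re_inner`). Each edge has at most two neighbours in the chain, so `H² ≥ (1 - 4/5)
H`, and the nonzero spectrum of `H` starts at 1/5 or above, whatever the length of the snake.

With `D` darts, `1 - M` dominates `H / D`, because the other darts only add nonnegative terms and do
not change the kernel. Hence the gap is at least `1 / (5 D)` (`norm_eigenvalue_le_of_chain`), and `D
≤ 2 d n`. -/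

theorem LinearMap.IsSymmetricProjection.apply_apply {P : E →ₗ[ℂ] E}
    (hP : P.IsSymmetricProjection) (x : E) : P (P x) = P x := by
  have h := hP.isIdempotentElem
  exact LinearMap.congr_fun h x

theorem LinearMap.IsSymmetricProjection.inner_apply_self {P : E →ₗ[ℂ] E}
    (hP : P.IsSymmetricProjection) (x : E) : inner ℂ x (P x) = inner ℂ (P x) (P x) := by
  rw [hP.isSymmetric, hP.apply_apply]

theorem LinearMap.IsSymmetricProjection.re_inner_apply_self {P : E →ₗ[ℂ] E}
    (hP : P.IsSymmetricProjection) (x : E) : (inner ℂ x (P x)).re = ‖P x‖ ^ 2 := by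
  rw [hP.inner_apply_self]
  exact inner_self_eq_norm_sq (𝕜 := ℂ) (P x)

theorem LinearMap.IsSymmetricProjection.norm_sub_apply_sq {P : E →ₗ[ℂ] E}
    (hP : P.IsSymmetricProjection) (x : E) : ‖x - P x‖ ^ 2 = ‖x‖ ^ 2 - ‖P x‖ ^ 2 := by
  have h : ‖x - P x‖ ^ 2 = ‖x‖ ^ 2 - 2 * (inner ℂ x (P x)).re + ‖P x‖ ^ 2 := norm_sub_sq (𝕜 := ℂ)
      x (P x)
  rw [h, hP.re_inner_apply_self]
  ring

theorem LinearMap.IsSymmetricProjection.norm_apply_le {P : E →ₗ[ℂ] E}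
    (hP : P.IsSymmetricProjection) (x : E) : ‖P x‖ ^ 2 ≤ ‖x‖ ^ 2 := by
  have := hP.norm_sub_apply_sq x
  nlinarith [sq_nonneg ‖x - P x‖]

theorem LinearMap.IsSymmetricProjection.re_inner_sub_sub {P : E →ₗ[ℂ] E}
    (hP : P.IsSymmetricProjection) (x : E) : (inner ℂ x (x - P x)).re = ‖x - P x‖ ^ 2 := by
  rw [inner_sub_right, Complex.sub_re, hP.re_inner_apply_self, hP.norm_sub_apply_sq]
  congr 1
  exact inner_self_eq_norm_sq (𝕜 := ℂ) x

/-- Two symmetric projections with `‖P Q x‖ ≤ (2/5) ‖P x‖` on the vector at hand. -/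
theorem neg_le_two_mul_re_inner_of_overlap {P Q : E →ₗ[ℂ] E} (hP : P.IsSymmetricProjection)
    (hQ : Q.IsSymmetricProjection) (x : E) (h : ‖Q (P x)‖ ^ 2 ≤ 4 / 25 * ‖P x‖ ^ 2) :
    -(2 / 5) * (‖x - P x‖ ^ 2 + ‖x - Q x‖ ^ 2) ≤ 2 * (inner ℂ (x - P x) (x - Q x)).re := by
  have h1 : ‖Q (P x)‖ ≤ 2 / 5 * ‖P x‖ := by
    refine abs_le_of_sq_le_sq' ?_ (by positivity) |>.2
    nlinarith
  have ht : inner ℂ (P x) (Q x) = inner ℂ (Q (P x)) (Q x) := by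
    rw [hQ.isSymmetric, hQ.apply_apply]
  have h2 : |(inner ℂ (P x) (Q x)).re| ≤ 2 / 5 * ‖P x‖ * ‖Q x‖ := by
    rw [ht]
    calc |(inner ℂ (Q (P x)) (Q x)).re| ≤ ‖inner ℂ (Q (P x)) (Q x)‖ := Complex.abs_re_le_norm _
      _ ≤ ‖Q (P x)‖ * ‖Q x‖ := norm_inner_le_norm _ _
      _ ≤ _ := by gcongr
  have h3 : (inner ℂ (x - P x) (x - Q x)).re =
      ‖x‖ ^ 2 - ‖Q x‖ ^ 2 - ‖P x‖ ^ 2 + (inner ℂ (P x) (Q x)).re := by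
    simp only [inner_sub_left, inner_sub_right, Complex.sub_re]
    rw [hQ.re_inner_apply_self, hP.isSymmetric, hP.re_inner_apply_self]
    have : (inner ℂ x x).re = ‖x‖ ^ 2 := inner_self_eq_norm_sq (𝕜 := ℂ) x
    rw [this]; ring
  have h4 : ‖P x‖ ^ 2 + ‖Q x‖ ^ 2 ≤ ‖x‖ * ‖P x + Q x‖ := by
    rw [← hP.re_inner_apply_self, ← hQ.re_inner_apply_self, ← Complex.add_re, ← inner_add_right]
    exact re_inner_le_norm (𝕜 := ℂ) _ _
  have h5 : ‖P x + Q x‖ ^ 2 = ‖P x‖ ^ 2 + 2 * (inner ℂ (P x) (Q x)).re + ‖Q x‖ ^ 2 :=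
    norm_add_sq (𝕜 := ℂ) _ _
  rw [h3, hP.norm_sub_apply_sq, hQ.norm_sub_apply_sq]
  obtain ⟨h2a, h2b⟩ := abs_le.mp h2
  generalize (inner ℂ (P x) (Q x)).re = t at *
  have h6 : (‖P x‖ ^ 2 + ‖Q x‖ ^ 2) ^ 2 ≤
      ‖x‖ ^ 2 * (‖P x‖ ^ 2 + 2 * t + ‖Q x‖ ^ 2) := by
    rw [← h5, ← mul_pow]
    gcongr
  have h7 := two_mul_le_add_sq ‖P x‖ ‖Q x‖
  have h8 : 0 ≤ ‖P x‖ ^ 2 + ‖Q x‖ ^ 2 := by positivity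
  have h9 : 0 ≤ ‖x‖ ^ 2 := by positivity
  generalize hs : ‖P x‖ ^ 2 + ‖Q x‖ ^ 2 = s at *
  have h10 : t ≤ s / 5 := by nlinarith
  have h11 : -(s / 5) ≤ t := by nlinarith
  have h12 : s ^ 2 ≤ ‖x‖ ^ 2 * (s + 2 * t) := by
    have : ‖P x‖ ^ 2 + 2 * t + ‖Q x‖ ^ 2 = s + 2 * t := by rw [← hs]; ring
    rwa [this] at h6
  generalize ‖x‖ ^ 2 = N at *
  -- This is the claim with everything moved to one side. If it failed, multiplying by `s + 2t > 0`
  -- and using the Cauchy–Schwarz bound `s² ≤ N (s + 2t)` would give `(s - 2t)(s - 5t) < 0`,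
  -- contradicting `t ≤ s / 5`.
  have h13 : 0 ≤ 14 / 5 * N - 12 / 5 * s + 2 * t := by
    rcases h8.eq_or_lt with h0 | h0
    · have : t = 0 := by linarith
      subst this; linarith
    · have hp : 0 < s + 2 * t := by linarith
      by_contra! hneg
      have := mul_neg_of_neg_of_pos hneg hp
      nlinarith [mul_nonneg (show 0 ≤ s - 2 * t by linarith) (show 0 ≤ s - 5 * t by linarith)]
  linarith

/-- The hypothesis `hkey` says that `25 P Q P - 4 P g` maps into the range of `Q`; it maps into that
of `P` anyway. Subtracting from `x` a suitable vector of the common range changes neither `x - P x`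
nor `x - Q x`, and what is left satisfies `P Q P = (4/25) P g`, which is the overlap bound. -/
theorem neg_le_two_mul_re_inner {P Q g : E →ₗ[ℂ] E} (hP : P.IsSymmetricProjection)
    (hQ : Q.IsSymmetricProjection) (hg : g.IsSymmetricProjection)
    (hPg : ∀ x, P (g x) = g (P x)) (hgQ : ∀ x, g (Q x) = Q x)
    (hkey : ∀ x, Q ((25 : ℂ) • P (Q (P x)) - (4 : ℂ) • P (g x)) =
      (25 : ℂ) • P (Q (P x)) - (4 : ℂ) • P (g x)) (x : E) :
    -(2 / 5) * (‖x - P x‖ ^ 2 + ‖x - Q x‖ ^ 2) ≤ 2 * (inner ℂ (x - P x) (x - Q x)).re := by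
  -- The operator `25 P Q P - 4 P g` is 25 - 4 = 21 on the common range, so `r` is the component of
  -- `x` there.
  set r : E := (1 / 21 : ℂ) • ((25 : ℂ) • P (Q (P x)) - (4 : ℂ) • P (g x)) with hr
  have hQr : Q r = r := by rw [hr, map_smul, hkey]
  have hPr : P r = r := by
    simp only [hr, map_smul, map_sub, hP.apply_apply]
  have hgr : g r = r := by rw [← hQr, hgQ]
  have e : P (Q (P (x - r))) = (4 / 25 : ℂ) • P (g (x - r)) := by
    simp only [map_sub, hPr, hQr, hgr]
    have : (25 : ℂ) • P (Q (P x)) = (4 : ℂ) • P (g x) + (21 : ℂ) • r := by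
      rw [hr, smul_smul]; norm_num
    have h2 : P (Q (P x)) = (1 / 25 : ℂ) • ((4 : ℂ) • P (g x) + (21 : ℂ) • r) := by
      rw [← this, smul_smul]; norm_num
    rw [h2]
    module
  have h1 : x - P x = (x - r) - P (x - r) := by rw [map_sub, hPr]; abel
  have h2 : x - Q x = (x - r) - Q (x - r) := by rw [map_sub, hQr]; abel
  rw [h1, h2]
  refine neg_le_two_mul_re_inner_of_overlap hP hQ _ ?_
  generalize x - r = y at *
  have h5 : inner ℂ y (P (g y)) = inner ℂ (P y) (g (P y)) := by rw [hP.isSymmetric, ← hPg,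
      hP.apply_apply]
  rw [← hQ.re_inner_apply_self, hP.isSymmetric, e, inner_smul_right, h5, hg.inner_apply_self]
  have h3 : (inner ℂ (g (P y)) (g (P y))) = ((‖g (P y)‖ ^ 2 : ℝ) : ℂ) := by
    rw [inner_self_eq_norm_sq_to_K]; push_cast; rfl
  have h4 := hg.norm_apply_le (P y)
  rw [h3]
  have : ((4 / 25 : ℂ) * ((‖g (P y)‖ ^ 2 : ℝ) : ℂ)).re = 4 / 25 * ‖g (P y)‖ ^ 2 := by
    rw [show (4 / 25 : ℂ) = ((4 / 25 : ℝ) : ℂ) by push_cast; rfl, ← Complex.ofReal_mul,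
      Complex.ofReal_re]
  rw [this]
  linarith

/-- A chain of vectors in which only neighbours can have a negative inner product. -/
theorem norm_sq_sum_range_ge {x : ℕ → E} {N : ℕ}
    (hfar : ∀ k l, l < N → k + 2 ≤ l → 0 ≤ (inner ℂ (x k) (x l)).re)
    (hnear : ∀ k, k + 1 < N →
      -(2 / 5) * (‖x k‖ ^ 2 + ‖x (k + 1)‖ ^ 2) ≤ 2 * (inner ℂ (x k) (x (k + 1))).re) :
    1 / 5 * ∑ k ∈ Finset.range N, ‖x k‖ ^ 2 ≤ ‖∑ k ∈ Finset.range N, x k‖ ^ 2 := by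
  -- The last vector has lost only one share of 2/5, having met one neighbour so far; the surplus
  -- pays for the next one.
  have key : ∀ n, n + 1 ≤ N → 1 / 5 * ∑ k ∈ Finset.range n, ‖x k‖ ^ 2 + 3 / 5 * ‖x n‖ ^ 2 ≤
      ‖∑ k ∈ Finset.range (n + 1), x k‖ ^ 2 := by
    intro n
    induction n with
    | zero => intro _; simp; nlinarith [sq_nonneg ‖x 0‖]
    | succ n ih =>
      intro hn
      have ih := ih (by omega)
      rw [Finset.sum_range_succ x (n + 1), Finset.sum_range_succ _ n]
      have h0 : ‖∑ k ∈ Finset.range (n + 1), x k + x (n + 1)‖ ^ 2 = ‖∑ k ∈ Finset.range (n + 1),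
          x k‖ ^ 2 +
        2 * (inner ℂ (∑ k ∈ Finset.range (n + 1), x k) (x (n + 1))).re + ‖x (n + 1)‖ ^ 2 :=
          norm_add_sq (𝕜 := ℂ) _ _
      have h1 : (inner ℂ (x n) (x (n + 1))).re ≤ (inner ℂ (∑ k ∈ Finset.range (n + 1), x k) (x (n
          + 1))).re := by
        rw [sum_inner, Finset.sum_range_succ, Complex.add_re, Complex.re_sum]
        have : 0 ≤ ∑ k ∈ Finset.range n, (inner ℂ (x k) (x (n + 1))).re :=
          Finset.sum_nonneg fun k hk => hfar k (n + 1) (by omega)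
            (by have := Finset.mem_range.mp hk; omega)
        linarith
      have h2 := hnear n (by omega)
      linarith
  cases N with
  | zero => simp
  | succ n =>
    have := key n le_rfl
    rw [Finset.sum_range_succ _ n]
    nlinarith [sq_nonneg ‖x n‖]

/-- From `H ≥ 0` and `H² ≥ H/5` to `H ≥ 1/5` off the kernel, without diagonalizing: `x = H z`, and
positivity of `H` is tested on a cleverly chosen vector. -/
theorem norm_sq_le_of_orthogonal_ker [FiniteDimensional ℂ E] {H : E →ₗ[ℂ] E} (hH : H.IsSymmetric)
    (hpos : ∀ x, 0 ≤ (inner ℂ x (H x)).re) (hgap : ∀ x, 1 / 5 * (inner ℂ x (H x)).re ≤ ‖H x‖ ^ 2)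
        {x : E}
    (hx : ∀ y, H y = 0 → inner ℂ y x = 0) : 1 / 5 * ‖x‖ ^ 2 ≤ (inner ℂ x (H x)).re := by
  have hmem : x ∈ LinearMap.range H := by
    rw [← Submodule.orthogonal_orthogonal (LinearMap.range H), hH.orthogonal_range]
    exact (Submodule.mem_orthogonal _ _).mpr fun y hy => hx y hy
  obtain ⟨z, rfl⟩ := hmem
  -- This is `H (1 - 5H)² ≥ 0`. Its expansion, together with `⟨z, H z⟩ ≤ 5 ‖H z‖²`, gives the bound
  -- at `H z`.
  have h := hpos (z - (5 : ℂ) • H z)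
  have e : (inner ℂ (z - (5 : ℂ) • H z) (H (z - (5 : ℂ) • H z))).re =
      (inner ℂ z (H z)).re - 10 * ‖H z‖ ^ 2 + 25 * (inner ℂ (H z) (H (H z))).re := by
    have h0 : (inner ℂ (H z) (H z)).re = ‖H z‖ ^ 2 := inner_self_eq_norm_sq (𝕜 := ℂ) (H z)
    simp only [map_sub, map_smul, inner_sub_left, inner_sub_right, inner_smul_left,
      inner_smul_right, Complex.sub_re, ← hH z (H z)]
    rw [← h0]
    simp
    ring
  rw [e] at h
  have := hgap z
  linarith

/-- The average of symmetric projections, some of which form a chain in which only neighbours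
fail to commute, has a spectral gap. -/
theorem norm_eigenvalue_le_of_chain [FiniteDimensional ℂ E] {ι : Type*} [Fintype ι] [Nonempty ι]
    {P : ι → E →ₗ[ℂ] E} (hP : ∀ e, (P e).IsSymmetricProjection) {N : ℕ} {c : ℕ → ι}
    (hc : Set.InjOn c (Finset.range N))
    (hfar : ∀ k l, l < N → k + 2 ≤ l → ∀ x, P (c k) (P (c l) x) = P (c l) (P (c k) x))
    (hnear : ∀ k, k + 1 < N → ∀ x,
      -(2 / 5) * (‖x - P (c k) x‖ ^ 2 + ‖x - P (c (k + 1)) x‖ ^ 2) ≤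
        2 * (inner ℂ (x - P (c k) x) (x - P (c (k + 1)) x)).re)
    (hfix : ∀ x, (∀ k < N, P (c k) x = x) → ∀ e, P e x = x)
    {x : E} (hx : x ≠ 0) {z : ℂ} (hz : z ≠ 1)
    (he : (Fintype.card ι : ℂ)⁻¹ • ∑ e, P e x = z • x) :
    ‖z‖ ≤ 1 - 1 / (5 * Fintype.card ι) := by
  have hD : (0 : ℝ) < Fintype.card ι := by exact_mod_cast Fintype.card_pos
  have hDc : (Fintype.card ι : ℂ) ≠ 0 := by exact_mod_cast hD.ne'
  have horth : ∀ y, (∀ e, P e y = y) → inner ℂ y x = 0 := by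
    intro y hy
    have h1 : inner ℂ y ((Fintype.card ι : ℂ)⁻¹ • ∑ e, P e x) = inner ℂ y x := by
      rw [inner_smul_right, inner_sum]
      have : ∀ e, inner ℂ y (P e x) = inner ℂ y x := fun e => by rw [← (hP e).isSymmetric, hy]
      simp only [this, Finset.sum_const, Finset.card_univ, nsmul_eq_mul]
      field_simp
    rw [he, inner_smul_right] at h1
    have : (z - 1) * inner ℂ y x = 0 := by rw [sub_mul, h1]; ring
    exact (mul_eq_zero.mp this).resolve_left (sub_ne_zero.mpr hz)
  set H : E →ₗ[ℂ] E := ∑ k ∈ Finset.range N, (LinearMap.id - P (c k)) with hHdef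
  have hHapp : ∀ y, H y = ∑ k ∈ Finset.range N, (y - P (c k) y) := by
    intro y; simp [hHdef, LinearMap.sum_apply]
  have hHsymm : H.IsSymmetric := by
    intro y w
    simp only [hHapp, sum_inner, inner_sum, inner_sub_left, inner_sub_right,
      (hP _).isSymmetric y w]
  have hHre : ∀ y, (inner ℂ y (H y)).re = ∑ k ∈ Finset.range N, ‖y - P (c k) y‖ ^ 2 := by
    intro y
    rw [hHapp, inner_sum, Complex.re_sum]
    exact Finset.sum_congr rfl fun k _ => (hP _).re_inner_sub_sub y
  have hcomm : ∀ k l, l < N → k + 2 ≤ l → ∀ y,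
      0 ≤ (inner ℂ (y - P (c k) y) (y - P (c l) y)).re := by
    intro k l hl hkl y
    -- A product of commuting projections is positive: one complement is idempotent and can be moved
    -- to both sides of the other.
    have e : inner ℂ (y - P (c k) y) (y - P (c l) y) =
        inner ℂ (y - P (c l) y) ((y - P (c l) y) - P (c k) (y - P (c l) y)) := by
      have h1 := hfar k l hl hkl y
      have h2 := (hP (c l)).isSymmetric y y
      have h3 := (hP (c k)).isSymmetric y y
      have h4 := (hP (c k)).isSymmetric y (P (c l) y)
      have h5 := (hP (c l)).isSymmetric y (P (c k) y)
      have h6 := (hP (c l)).isSymmetric y (P (c l) y)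
      have h8 := (hP (c l)).apply_apply y
      have h9 := (hP (c l)).isSymmetric y (P (c l) (P (c k) y))
      have h10 := (hP (c l)).apply_apply (P (c k) y)
      simp only [map_sub, inner_sub_left, inner_sub_right, h2, h3, h4, h5, h6, h8, h1, h9, h10]
      ring
    rw [e, (hP _).re_inner_sub_sub]
    positivity
  have hkey : 1 / 5 * ‖x‖ ^ 2 ≤ (inner ℂ x (H x)).re := by
    refine norm_sq_le_of_orthogonal_ker hHsymm ?_ ?_ ?_
    · intro y; rw [hHre]; positivity
    · intro y
      rw [hHre, hHapp]
      exact norm_sq_sum_range_ge (x := fun k => y - P (c k) y)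
        (fun k l hl hkl => hcomm k l hl hkl y) (fun k hk => hnear k hk y)
    · intro y hy
      refine horth y (hfix y fun k hk => ?_)
      have h0 := hHre y
      rw [hy, inner_zero_right, Complex.zero_re] at h0
      have := (Finset.sum_eq_zero_iff_of_nonneg (fun k _ => by positivity)).mp h0.symm k
        (Finset.mem_range.mpr hk)
      have h1 : ‖y - P (c k) y‖ = 0 := by simpa using this
      exact (sub_eq_zero.mp (norm_eq_zero.mp h1)).symm
  -- Projections outside the chain contribute nonnegatively; injectivity of `c` prevents double
  -- counting.
  have hsub : ∑ k ∈ Finset.range N, ‖x - P (c k) x‖ ^ 2 ≤ ∑ e, ‖x - P e x‖ ^ 2 := by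
    classical
    rw [← Finset.sum_image (f := fun e => ‖x - P e x‖ ^ 2) hc]
    exact Finset.sum_le_sum_of_subset_of_nonneg (Finset.subset_univ _) fun _ _ _ => by positivity
  have hx2 : 0 < ‖x‖ ^ 2 := by positivity
  -- The Rayleigh quotient shows that `z` is real and nonnegative, so no eigenvalue near -1 has to
  -- be excluded.
  have hzr : z * (‖x‖ ^ 2 : ℝ) = (((Fintype.card ι : ℝ)⁻¹ * ∑ e, ‖P e x‖ ^ 2 : ℝ) : ℂ) := by
    have h1 : inner ℂ x (z • x) = z * (‖x‖ ^ 2 : ℝ) := by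
      rw [inner_smul_right, inner_self_eq_norm_sq_to_K]; push_cast; rfl
    rw [← h1, ← he, inner_smul_right, inner_sum]
    push_cast
    congr 1
    refine Finset.sum_congr rfl fun e _ => ?_
    rw [(hP e).inner_apply_self, inner_self_eq_norm_sq_to_K]
    rfl
  have hnorm : ‖z‖ * ‖x‖ ^ 2 = (Fintype.card ι : ℝ)⁻¹ * ∑ e, ‖P e x‖ ^ 2 := by
    have h1 := congrArg norm hzr
    rw [norm_mul, Complex.norm_of_nonneg hx2.le, Complex.norm_of_nonneg (by positivity)] at h1
    exact h1
  have hsum : ∑ e, ‖P e x‖ ^ 2 = Fintype.card ι * ‖x‖ ^ 2 - ∑ e, ‖x - P e x‖ ^ 2 := by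
    simp only [(hP _).norm_sub_apply_sq, Finset.sum_sub_distrib, Finset.sum_const, Finset.card_univ,
      nsmul_eq_mul]
    ring
  rw [hHre] at hkey
  refine le_of_mul_le_mul_right ?_ hx2
  rw [hnorm, hsum, mul_sub, inv_mul_cancel_left₀ hD.ne', sub_mul, one_mul]
  have : 1 / (5 * (Fintype.card ι : ℝ)) * ‖x‖ ^ 2 = (Fintype.card ι : ℝ)⁻¹ * (1 / 5 * ‖x‖ ^ 2) := by
    field_simp
  rw [this]
  have : (Fintype.card ι : ℝ)⁻¹ * (1 / 5 * ‖x‖ ^ 2) ≤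
      (Fintype.card ι : ℝ)⁻¹ * ∑ e, ‖x - P e x‖ ^ 2 := by gcongr; linarith
  linarith

/-- If the average fixes `x`, then `∑ ‖x - P e x‖² = ⟨x, ∑ (x - P e x)⟩ = 0`, so every term
vanishes. -/
theorem average_apply_eq_self_iff {ι : Type*} [Fintype ι] [Nonempty ι]
    {P : ι → E →ₗ[ℂ] E} (hP : ∀ e, (P e).IsSymmetricProjection) (x : E) :
    (Fintype.card ι : ℂ)⁻¹ • ∑ e, P e x = x ↔ ∀ e, P e x = x := by
  have hD : (Fintype.card ι : ℂ) ≠ 0 := by exact_mod_cast Fintype.card_ne_zero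
  constructor
  · intro h
    have h1 : ∑ e, (x - P e x) = 0 := by
      rw [Finset.sum_sub_distrib, Finset.sum_const, Finset.card_univ, ← Nat.cast_smul_eq_nsmul ℂ]
      rw [sub_eq_zero, ← smul_inv_smul₀ hD (∑ e, P e x), h]
    have h2 : ∑ e, ‖x - P e x‖ ^ 2 = 0 := by
      have h3 : (inner ℂ x (∑ e, (x - P e x))).re = 0 := by rw [h1]; simp
      rw [inner_sum, Complex.re_sum] at h3
      rw [← h3]
      exact Finset.sum_congr rfl fun e _ => ((hP e).re_inner_sub_sub x).symm
    intro e
    have := (Finset.sum_eq_zero_iff_of_nonneg (fun k _ => by positivity)).mp h2 e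
      (Finset.mem_univ _)
    have h1 : ‖x - P e x‖ = 0 := by simpa using this
    exact (sub_eq_zero.mp (norm_eq_zero.mp h1)).symm
  · intro h
    simp only [h, Finset.sum_const, Finset.card_univ, ← Nat.cast_smul_eq_nsmul ℂ,
      inv_smul_smul₀ hD]

end Hilbert

/-! ### Rank-one operators on one tensor factor. -/

section SiteOperators

variable {V X : Type*} [DecidableEq V] [Fintype X]

/-- The operator `|u⟩⟨v|` (for real-valued `v`) acting on the tensor factor `k` of `⨂_V ℂ^X`. -/
noncomputable def siteOp (k : V) (u v : X → ℂ) : Module.End ℂ (EuclideanSpace ℂ (V → X)) where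
  toFun f := WithLp.toLp 2 fun y => u (y k) * ∑ x, v x * f (Function.update y k x)
  map_add' f g := by
    ext y
    simp [mul_add, Finset.sum_add_distrib]
  map_smul' c f := by
    ext y
    simp only [PiLp.smul_apply, smul_eq_mul, RingHom.id_apply, Finset.mul_sum]
    exact Finset.sum_congr rfl fun x _ => by ring

theorem siteOp_apply (k : V) (u v : X → ℂ) (f : EuclideanSpace ℂ (V → X)) (y : V → X) :
    siteOp k u v f y = u (y k) * ∑ x, v x * f (Function.update y k x) := rfl

theorem siteOp_mul_siteOp (k : V) (u v u' v' : X → ℂ) :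
    siteOp k u v * siteOp k u' v' = (∑ x, v x * u' x) • siteOp k u v' := by
  ext f y
  simp only [Module.End.mul_apply, siteOp_apply, LinearMap.smul_apply, PiLp.smul_apply,
    Function.update_self, Function.update_idem, smul_eq_mul]
  simp only [← mul_assoc (v _), ← Finset.sum_mul]
  ring

theorem siteOp_commute {k l : V} (h : k ≠ l) (u v u' v' : X → ℂ) :
    Commute (siteOp k u v) (siteOp l u' v') := by
  ext f y
  simp only [Module.End.mul_apply, siteOp_apply, Function.update_of_ne h, Function.update_of_ne
      h.symm,
    Finset.mul_sum]
  rw [Finset.sum_comm]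
  refine Finset.sum_congr rfl fun x _ => Finset.sum_congr rfl fun x' _ => ?_
  rw [Function.update_comm h]
  ring

theorem inner_siteOp_left [Fintype V] (k : V) {u v : X → ℂ} (hu : ∀ x, star (u x) = u x)
    (hv : ∀ x, star (v x) = v x) (f g : EuclideanSpace ℂ (V → X)) :
    inner ℂ (siteOp k u v f) g = inner ℂ f (siteOp k v u g) := by
  simp only [PiLp.inner_apply, siteOp_apply, RCLike.inner_apply, map_mul, map_sum,
    Finset.mul_sum, Finset.sum_mul]
  have hu' : ∀ x, (starRingEnd ℂ) (u x) = u x := hu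
  have hv' : ∀ x, (starRingEnd ℂ) (v x) = v x := hv
  simp only [hu', hv', ← Fintype.sum_prod_type']
  -- Exchanging the value at `k` with the summation variable is an involution that swaps the two
  -- matrix indices.
  let e : (V → X) × X ≃ (V → X) × X :=
    { toFun := fun p => (Function.update p.1 k p.2, p.1 k)
      invFun := fun p => (Function.update p.1 k p.2, p.1 k)
      left_inv := fun p => by simp
      right_inv := fun p => by simp }
  refine Fintype.sum_equiv e _ _ fun p => ?_
  simp only [e, Equiv.coe_fn_mk, Function.update_self, Function.update_idem,
    Function.update_eq_self]
  ring

end SiteOperators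

/-! ### Projections onto identity and swap, on one and two sites, and their common fixed vectors. -/

section PermutationStates

/-- The indices of an operator on two copies of a qubit. -/
abbrev TwoCopyIndex := (Fin 2 × Fin 2) × (Fin 2 × Fin 2)

/-- The matrix entries of the identity (`false`) and the swap (`true`) of two qubits. -/
def permState (s : Bool) (x : TwoCopyIndex) : ℂ :=
  if x.1 = (bif s then x.2.swap else x.2) then 1 else 0

theorem star_permState (s : Bool) (x : TwoCopyIndex) : star (permState s x) = permState s x := by
  unfold permState; split_ifs <;> simp

theorem sum_permState_mul (s t : Bool) :
    ∑ x, permState s x * permState t x = if s = t then 4 else 2 := by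
  cases s <;> cases t <;>
    simp only [permState, Fintype.sum_prod_type, Fin.sum_univ_two] <;> simp <;> norm_num

/-- An entry at which exactly one of the two permutation operators is nonzero. -/
def permPoint (s : Bool) : TwoCopyIndex := ((0, 1), bif s then (1, 0) else (0, 1))

theorem permState_permPoint (s t : Bool) : permState s (permPoint t) = if s = t then 1 else 0 := by
  cases s <;> cases t <;> simp [permState, permPoint]

variable {V : Type*} [DecidableEq V]

/-- `siteOp` for the permutation operators. -/
noncomputable def permOp (k : V) (s t : Bool) : Module.End ℂ (EuclideanSpace ℂ (V →
    TwoCopyIndex)) :=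
  siteOp k (permState s) (permState t)

theorem permOp_mul_siteOp (k : V) (s t u : Bool) (v : TwoCopyIndex → ℂ) :
    permOp k s t * siteOp k (permState u) v =
      (if t = u then (4 : ℂ) else 2) • siteOp k (permState s) v := by
  rw [permOp, siteOp_mul_siteOp, sum_permState_mul]

/-- The projection of the tensor factor `k` onto the span of the permutation operators. -/
noncomputable def siteProj (k : V) : Module.End ℂ (EuclideanSpace ℂ (V → TwoCopyIndex)) :=
  -- The coefficients form the inverse of the Gram matrix with entries 4 (diagonal) and 2.
  ∑ s, ∑ t, (if s = t then (1 / 3 : ℂ) else -1 / 6) • permOp k s t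

/-- The projection of the tensor factors `i` and `j` onto the span of the permutation operators. -/
noncomputable def pairProj (i j : V) : Module.End ℂ (EuclideanSpace ℂ (V → TwoCopyIndex)) :=
  -- The two-site Gram matrix has entries 16 and 4; this is its inverse.
  ∑ s, ∑ t, (if s = t then (4 / 60 : ℂ) else -1 / 60) • (permOp i s t * permOp j s t)

theorem permOp_commute {k l : V} (h : k ≠ l) (s t u v : Bool) :
    Commute (permOp k s t) (permOp l u v) := siteOp_commute h _ _ _ _

theorem inner_permOp_left [Fintype V] (k : V) (s t : Bool) (f g : EuclideanSpace ℂ (V →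
    TwoCopyIndex)) :
    inner ℂ (permOp k s t f) g = inner ℂ f (permOp k t s g) :=
  inner_siteOp_left k (star_permState s) (star_permState t) f g

theorem siteProj_mul_siteOp (k : V) (s : Bool) (v : TwoCopyIndex → ℂ) :
    siteProj k * siteOp k (permState s) v = siteOp k (permState s) v := by
  simp only [siteProj, Finset.sum_mul, smul_mul_assoc, permOp_mul_siteOp]
  simp only [Fintype.sum_bool]
  cases s <;> simp <;> module

/-- A mixed product state has inner product 4 · 2 = 8 with both aligned ones, whence the factor 8 ·
(4 - 1)/60 = 2/5. All later constants come from it. -/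
theorem pairProj_mul_siteOp {i j : V} (h : i ≠ j) (s t : Bool) (u v : TwoCopyIndex → ℂ) :
    pairProj i j * (siteOp i (permState s) u * siteOp j (permState t) v) =
      if s = t then siteOp i (permState s) u * siteOp j (permState t) v
      else (2 / 5 : ℂ) • ∑ r, siteOp i (permState r) u * siteOp j (permState r) v := by
  have e : ∀ a b : Bool, permOp i a b * permOp j a b *
      (siteOp i (permState s) u * siteOp j (permState t) v) =
      ((if b = s then (4 : ℂ) else 2) * (if b = t then (4 : ℂ) else 2)) •
        (siteOp i (permState a) u * siteOp j (permState a) v) := by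
    intro a b
    rw [mul_assoc, ← mul_assoc (permOp j a b),
      show permOp j a b * siteOp i (permState s) u = siteOp i (permState s) u * permOp j a b from
        siteOp_commute h.symm _ _ _ _, mul_assoc, permOp_mul_siteOp, ← mul_assoc,
      permOp_mul_siteOp, smul_mul_smul_comm]
  simp only [pairProj, Finset.sum_mul, smul_mul_assoc, e]
  simp only [Fintype.sum_bool]
  cases s <;> cases t <;> simp <;> module

theorem pairProj_mul_permOp {i j : V} (h : i ≠ j) (s t u : Bool) :
    pairProj i j * (permOp i s t * permOp j s u) = permOp i s t * permOp j s u := by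
  rw [permOp, permOp, pairProj_mul_siteOp h, if_pos rfl]

theorem pairProj_comm {i j : V} (h : i ≠ j) : pairProj i j = pairProj j i := by
  unfold pairProj
  simp only [(permOp_commute h _ _ _ _).eq]

theorem siteProj_isSymmetricProjection [Fintype V] (k : V) :
    LinearMap.IsSymmetricProjection (siteProj k) where
  isIdempotentElem := by
    change siteProj k * siteProj k = siteProj k
    conv_lhs => rhs; rw [siteProj]
    simp only [Finset.mul_sum, mul_smul_comm, permOp, siteProj_mul_siteOp]
    rfl
  isSymmetric := by
    intro f g
    simp only [siteProj, LinearMap.sum_apply, LinearMap.smul_apply, sum_inner, inner_sum,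
      inner_smul_left, inner_smul_right, inner_permOp_left]
    rw [Finset.sum_comm]
    refine Finset.sum_congr rfl fun s _ => Finset.sum_congr rfl fun t _ => ?_
    by_cases hst : s = t
    · simp [hst, Complex.conj_ofNat]
    · simp [hst, Ne.symm hst, Complex.conj_ofNat]

theorem pairProj_isSymmetricProjection [Fintype V] {i j : V} (h : i ≠ j) :
    LinearMap.IsSymmetricProjection (pairProj i j) where
  isIdempotentElem := by
    change pairProj i j * pairProj i j = pairProj i j
    conv_lhs => rhs; rw [pairProj]
    simp only [Finset.mul_sum, mul_smul_comm, pairProj_mul_permOp h]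
    rfl
  isSymmetric := by
    intro f g
    have e : ∀ s t, permOp j t s * permOp i t s = permOp i t s * permOp j t s := fun s t =>
      (permOp_commute h.symm _ _ _ _).eq
    simp only [pairProj, LinearMap.sum_apply, LinearMap.smul_apply, sum_inner, inner_sum,
      inner_smul_left, inner_smul_right, Module.End.mul_apply, inner_permOp_left]
    simp only [← Module.End.mul_apply, e]
    rw [Finset.sum_comm]
    refine Finset.sum_congr rfl fun s _ => Finset.sum_congr rfl fun t _ => ?_
    by_cases hst : s = t
    · simp [hst, Complex.conj_ofNat]
    · simp [hst, Ne.symm hst, Complex.conj_ofNat]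

theorem siteProj_mul_pairProj_left (i j : V) : siteProj i * pairProj i j = pairProj i j := by
  conv_lhs => rw [pairProj]
  simp only [Finset.mul_sum, mul_smul_comm, ← mul_assoc]
  simp only [permOp, siteProj_mul_siteOp]
  rfl

theorem siteProj_mul_pairProj_right {i j : V} (h : i ≠ j) :
    siteProj j * pairProj i j = pairProj i j := by
  rw [pairProj_comm h, siteProj_mul_pairProj_left]

theorem permOp_mul_siteProj (k : V) (s t : Bool) : permOp k s t * siteProj k = permOp k s t := by
  have e : ∀ u v, permOp k s t * permOp k u v = (if t = u then (4 : ℂ) else 2) • permOp k s v :=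
    fun u v => permOp_mul_siteOp k s t u _
  simp only [siteProj, Finset.mul_sum, mul_smul_comm, e]
  simp only [Fintype.sum_bool]
  cases t <;> simp <;> module

theorem pairProj_mul_siteProj_right (i j : V) : pairProj i j * siteProj j = pairProj i j := by
  simp only [pairProj, Finset.sum_mul, smul_mul_assoc, mul_assoc, permOp_mul_siteProj]

theorem permOp_commute_pairProj {i j k : V} (hi : i ≠ k) (hj : j ≠ k) (s t : Bool) :
    Commute (pairProj i j) (permOp k s t) := by
  unfold pairProj
  refine Commute.sum_left _ _ _ fun u _ => Commute.sum_left _ _ _ fun v _ =>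
    Commute.smul_left ?_ _
  exact (permOp_commute hi _ _ _ _).mul_left (permOp_commute hj _ _ _ _)

theorem siteProj_commute_pairProj {i j k : V} (hi : i ≠ k) (hj : j ≠ k) :
    Commute (pairProj i j) (siteProj k) := by
  unfold siteProj
  exact Commute.sum_right _ _ _ fun u _ => Commute.sum_right _ _ _ fun v _ =>
    (permOp_commute_pairProj hi hj u v).smul_right _

theorem pairProj_commute {i j k l : V} (hik : i ≠ k) (hil : i ≠ l) (hjk : j ≠ k) (hjl : j ≠ l) :
    Commute (pairProj i j) (pairProj k l) := by
  conv_lhs => unfold pairProj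
  refine Commute.sum_left _ _ _ fun u _ => Commute.sum_left _ _ _ fun v _ =>
    Commute.smul_left ?_ _
  exact (permOp_commute_pairProj hik.symm hil.symm u v).symm.mul_left
    (permOp_commute_pairProj hjk.symm hjl.symm u v).symm

/-- The range of `P g` is spanned by the states `r r q` on the sites `i, j, k`. Those with `r = q`
are fixed by `P` and `Q`. For `r ≠ q`, modulo these, `P Q` multiplies `r r q` by (2/5)² = 4/25, so
the combination lands in the common range. -/
theorem pairProj_three_site {i j k : V} (hij : i ≠ j) (hjk : j ≠ k) (hik : i ≠ k) :
    pairProj j k * ((25 : ℂ) • (pairProj i j * pairProj j k * pairProj i j) -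
        (4 : ℂ) • (pairProj i j * siteProj k)) =
      (25 : ℂ) • (pairProj i j * pairProj j k * pairProj i j) -
        (4 : ℂ) • (pairProj i j * siteProj k) := by
  set P := pairProj i j with hP
  set Q := pairProj j k with hQ
  set g := siteProj k with hg
  have hQg : Q * g = Q := pairProj_mul_siteProj_right j k
  have hPg : P * g = g * P := (siteProj_commute_pairProj hik hjk).eq
  -- The identity on the states `r r q`, the labels `a b c` being spectators.
  have hX : ∀ a b c r q : Bool,
      (25 : ℂ) • (Q * (P * (Q * (permOp i r a * (permOp j r b * permOp k q c))))) -
        (4 : ℂ) • (Q * (permOp i r a * (permOp j r b * permOp k q c))) =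
      (25 : ℂ) • (P * (Q * (permOp i r a * (permOp j r b * permOp k q c)))) -
        (4 : ℂ) • (permOp i r a * (permOp j r b * permOp k q c)) := by
    intro a b c r q
    have hPT : ∀ s t r, P * (permOp i s a * (permOp j t b * permOp k r c)) =
        if s = t then permOp i s a * (permOp j t b * permOp k r c) else
          (2 / 5 : ℂ) • ∑ q, permOp i q a * (permOp j q b * permOp k r c) := by
      intro s t r
      simp only [← mul_assoc]
      rw [mul_assoc P, permOp, permOp, hP, pairProj_mul_siteOp hij]
      split_ifs
      · rfl
      · rw [smul_mul_assoc, Finset.sum_mul]; rfl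
    have hQT : ∀ s t r, Q * (permOp i s a * (permOp j t b * permOp k r c)) =
        if t = r then permOp i s a * (permOp j t b * permOp k r c) else
          (2 / 5 : ℂ) • ∑ q, permOp i s a * (permOp j q b * permOp k q c) := by
      intro s t r
      have hc : Q * permOp i s a = permOp i s a * Q :=
        (permOp_commute_pairProj hij.symm hik.symm s a).eq
      rw [← mul_assoc, hc, mul_assoc, permOp, permOp, permOp, hQ, pairProj_mul_siteOp hjk]
      split_ifs
      · rfl
      · rw [mul_smul_comm, Finset.mul_sum]; rfl
    cases r <;> cases q <;>
      simp only [hQT, hPT, if_true, if_false, Fintype.sum_bool, mul_smul_comm, mul_add,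
        reduceCtorEq] <;> module
  -- Since `Q` absorbs `g`, everything factors through `P g` on the right, which is a combination of
  -- operators covered by `hX`.
  have hPgX : (25 : ℂ) • (P * Q * P) - (4 : ℂ) • (P * g) =
      (25 : ℂ) • (P * (Q * (P * g))) - (4 : ℂ) • (P * g) := by
    rw [hPg, ← mul_assoc Q, hQg, mul_assoc]
  rw [hPgX, mul_sub, mul_smul_comm, mul_smul_comm]
  have hPgsum : P * g = ∑ s, ∑ t, ∑ u, ∑ v, ((if s = t then (4 / 60 : ℂ) else -1 / 60) *
      (if u = v then (1 / 3 : ℂ) else -1 / 6)) •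
        (permOp i s t * (permOp j s t * permOp k u v)) := by
    simp only [hP, hg, pairProj, siteProj, Finset.sum_mul]
    simp only [Finset.mul_sum, smul_mul_smul_comm, mul_assoc]
  rw [hPgsum]
  simp only [Finset.mul_sum, mul_smul_comm, Finset.smul_sum, ← Finset.sum_sub_distrib]
  refine Finset.sum_congr rfl fun s _ => Finset.sum_congr rfl fun t _ =>
    Finset.sum_congr rfl fun u _ => Finset.sum_congr rfl fun v _ => ?_
  rw [smul_comm (25 : ℂ), smul_comm (4 : ℂ), smul_comm (25 : ℂ), smul_comm (4 : ℂ), ← smul_sub,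
    ← smul_sub, hX]

/-- The product of the permutation operators on all tensor factors. -/
noncomputable def globalState [Fintype V] (s : Bool) : EuclideanSpace ℂ (V → TwoCopyIndex) :=
  WithLp.toLp 2 fun y => ∏ k, permState s (y k)

/-- The (non-orthogonal) projection onto a permutation operator at the tensor factor `k`. -/
noncomputable def pointOp (k : V) (s : Bool) :
    Module.End ℂ (EuclideanSpace ℂ (V → TwoCopyIndex)) :=
  siteOp k (permState s) (Pi.single (permPoint s) 1)

theorem pointOp_apply (k : V) (s : Bool) (f : EuclideanSpace ℂ (V → TwoCopyIndex))
    (y : V → TwoCopyIndex) :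
    pointOp k s f y = permState s (y k) * f (Function.update y k (permPoint s)) := by
  simp [pointOp, siteOp_apply, Pi.single_apply]

theorem pointOp_mul_siteOp (k : V) (s t : Bool) (v : TwoCopyIndex → ℂ) :
    pointOp k s * siteOp k (permState t) v =
      if s = t then siteOp k (permState s) v else 0 := by
  rw [pointOp, siteOp_mul_siteOp]
  have : ∑ x, (Pi.single (permPoint s) 1 : TwoCopyIndex → ℂ) x * permState t x =
      if s = t then 1 else 0 := by
    simp [Pi.single_apply, permState_permPoint, eq_comm]
  rw [this]
  split_ifs <;> simp

theorem pointOp_mul_self (k : V) (s : Bool) : pointOp k s * pointOp k s = pointOp k s := by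
  conv_lhs => rhs; rw [pointOp]
  rw [pointOp_mul_siteOp, if_pos rfl, pointOp]

theorem pointOp_mul_pairProj_left (i j : V) (s : Bool) :
    pointOp i s * pairProj i j =
      ∑ t, (if s = t then (4 / 60 : ℂ) else -1 / 60) • (permOp i s t * permOp j s t) := by
  unfold pairProj
  simp only [Finset.mul_sum, mul_smul_comm, ← mul_assoc]
  rw [Finset.sum_eq_single s]
  · simp only [permOp, pointOp_mul_siteOp, if_true]
  · intro t _ ht
    simp only [permOp, pointOp_mul_siteOp, if_neg (Ne.symm ht)]
    simp
  · simp

/-- In the range of `pairProj` the two sites carry the same permutation, so its `s` component can be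
read off at either site. -/
theorem pointOp_mul_pairProj_right {i j : V} (h : i ≠ j) (s : Bool) :
    pointOp j s * pairProj i j = pointOp i s * pairProj i j := by
  rw [pointOp_mul_pairProj_left, pairProj_comm h, pointOp_mul_pairProj_left]
  simp only [(permOp_commute h _ _ _ _).eq]

theorem sum_pointOp_mul_pairProj (i j : V) : ∑ s, pointOp i s * pairProj i j = pairProj i j := by
  simp only [pointOp_mul_pairProj_left]
  rfl

theorem pointOp_globalState [Fintype V] (k : V) (s : Bool) :
    pointOp k s (globalState s) = globalState s := by
  ext y
  rw [pointOp_apply]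
  simp only [globalState]
  rw [← Finset.mul_prod_erase _ _ (Finset.mem_univ k), ← Finset.mul_prod_erase _ _
      (Finset.mem_univ k),
    Function.update_self, permState_permPoint, if_pos rfl, one_mul]
  congr 1
  refine Finset.prod_congr rfl fun l hl => ?_
  rw [Function.update_of_ne (Finset.ne_of_mem_erase hl)]

theorem pairProj_globalState [Fintype V] {i j : V} (h : i ≠ j) (s : Bool) :
    pairProj i j (globalState s) = globalState s := by
  have e : pairProj i j * (pointOp i s * pointOp j s) = pointOp i s * pointOp j s := by
    rw [pointOp, pointOp, pairProj_mul_siteOp h, if_pos rfl]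
  have h1 := LinearMap.congr_fun e (globalState s)
  simpa only [Module.End.mul_apply, pointOp_globalState] using h1

/-- Each coordinate in turn can be reset to the reference point at the cost of a factor `permState
s`, so the value of `f` at the reference configuration determines `f`. -/
theorem eq_smul_globalState [Fintype V] {s : Bool} {f : EuclideanSpace ℂ (V → TwoCopyIndex)}
    (hf : ∀ k, pointOp k s f = f) : f = f (fun _ => permPoint s) • globalState s := by
  have key : ∀ (S : Finset V) (y : V → TwoCopyIndex), f y =
      (∏ k ∈ S, permState s (y k)) * f (S.piecewise (fun _ => permPoint s) y) := by
    intro S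
    induction S using Finset.induction_on with
    | empty => intro y; simp
    | insert k S hk ih =>
      intro y
      rw [ih y, Finset.prod_insert hk, Finset.piecewise_insert]
      conv_lhs => rw [← hf k]
      rw [pointOp_apply, Finset.piecewise_eq_of_notMem _ _ _ hk]
      ring
  ext y
  rw [key Finset.univ y, Finset.piecewise_univ]
  simp [globalState, mul_comm]

/-- The common fixed vectors of the pair projections along a path through all sites. -/
theorem mem_span_globalState [Fintype V] {n : ℕ} {c : ℕ → V} (hc : ∀ v, ∃ k < n, c k = v)
    (hn : 2 ≤ n) (hne : ∀ k, k + 1 < n → c k ≠ c (k + 1)) {f : EuclideanSpace ℂ (V → TwoCopyIndex)}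
    (hf : ∀ k, k + 1 < n → pairProj (c k) (c (k + 1)) f = f) :
    f ∈ Submodule.span ℂ {globalState false, globalState true} := by
  -- The `s` component of `f` is carried along the path from site to site.
  have hstep : ∀ s k, k < n → pointOp (c k) s f = pointOp (c 0) s f := by
    intro s k
    induction k with
    | zero => intro _; rfl
    | succ k ih =>
      intro hk
      rw [← ih (by omega), ← hf k hk, ← Module.End.mul_apply, ← Module.End.mul_apply,
        pointOp_mul_pairProj_right (hne k hk)]
  have hfix : ∀ s v, pointOp v s (pointOp (c 0) s f) = pointOp (c 0) s f := by
    intro s v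
    obtain ⟨k, hk, rfl⟩ := hc v
    rw [← hstep s k hk, ← Module.End.mul_apply, pointOp_mul_self]
  have hsum : f = ∑ s, pointOp (c 0) s f := by
    have h1 := LinearMap.congr_fun (sum_pointOp_mul_pairProj (c 0) (c 1)) f
    simp only [LinearMap.sum_apply, Module.End.mul_apply] at h1
    rw [hf 0 (by omega)] at h1
    exact h1.symm
  rw [hsum, Fintype.sum_bool]
  refine Submodule.add_mem _ ?_ ?_
  · rw [eq_smul_globalState (hfix true)]
    exact Submodule.smul_mem _ _ (Submodule.subset_span (by simp))
  · rw [eq_smul_globalState (hfix false)]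
    exact Submodule.smul_mem _ _ (Submodule.subset_span (by simp))

end PermutationStates

/-! ### Invariance and conserved traces of second-moment operators. -/

section SecondMoment

variable {q : Type*} [Fintype q]

/-- Conjugation of an operator on two copies by `U ⊗ U`. -/
def conjTwoCopies (U : Matrix q q ℂ) (Z : Matrix (q × q) (q × q) ℂ) : Matrix (q × q) (q × q) ℂ :=
  (U ⊗ₖ U) * Z * (U ⊗ₖ U).conjTranspose

theorem conjTwoCopies_mul (U V : Matrix q q ℂ) (Z : Matrix (q × q) (q × q) ℂ) :
    conjTwoCopies (U * V) Z = conjTwoCopies U (conjTwoCopies V Z) := by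
  simp only [conjTwoCopies, Matrix.mul_kronecker_mul, Matrix.conjTranspose_mul, Matrix.mul_assoc]

variable [DecidableEq q]

theorem continuous_conjTwoCopies (Z : Matrix (q × q) (q × q) ℂ) :
    Continuous fun U : Matrix.unitaryGroup q ℂ => conjTwoCopies U.1 Z := by
  have hk : Continuous (fun U : Matrix.unitaryGroup q ℂ => U.1 ⊗ₖ U.1) := by
    refine continuous_matrix fun i j => ?_
    have h : ∀ i j : q, Continuous (fun U : Matrix.unitaryGroup q ℂ => U.1 i j) :=
      fun i j => continuous_subtype_val.matrix_elem i j
    exact (h _ _).mul (h _ _)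
  exact (hk.matrix_mul continuous_const).matrix_mul hk.matrix_conjTranspose

theorem integrable_conjTwoCopies_apply (p : Measure (Matrix.unitaryGroup q ℂ)) [IsFiniteMeasure p]
    (Z : Matrix (q × q) (q × q) ℂ) (a b : q × q) :
    Integrable (fun U : Matrix.unitaryGroup q ℂ => conjTwoCopies U.1 Z a b) p :=
  integrableOn_univ.mp (((continuous_conjTwoCopies Z).matrix_elem a
    b).continuousOn.integrableOn_compact isCompact_univ)

theorem secondMoment_apply (p : Measure (Matrix.unitaryGroup q ℂ)) [IsFiniteMeasure p]
    (Z : Matrix (q × q) (q × q) ℂ) (a b : q × q) :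
    secondMoment p Z a b = ∫ U : Matrix.unitaryGroup q ℂ, conjTwoCopies U.1 Z a b ∂p := rfl

theorem linearMap_secondMoment (p : Measure (Matrix.unitaryGroup q ℂ)) [IsFiniteMeasure p]
    (l : Matrix (q × q) (q × q) ℂ →ₗ[ℂ] ℂ) (Z : Matrix (q × q) (q × q) ℂ) :
    l (secondMoment p Z) = ∫ U : Matrix.unitaryGroup q ℂ, l (conjTwoCopies U.1 Z) ∂p := by
  have e : ∀ W : Matrix (q × q) (q × q) ℂ, l W = ∑ a, ∑ b, W a b * l (Matrix.single a b 1) := by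
    intro W
    conv_lhs => rw [Matrix.matrix_eq_sum_single W]
    simp only [map_sum]
    refine Finset.sum_congr rfl fun a _ => Finset.sum_congr rfl fun b _ => ?_
    rw [← smul_eq_mul, ← map_smul, Matrix.smul_single, smul_eq_mul, mul_one]
  rw [e]
  simp_rw [e (conjTwoCopies _ _)]
  rw [integral_finsetSum _ fun a _ => integrable_finsetSum _ fun b _ =>
    (integrable_conjTwoCopies_apply p Z a b).mul_const _]
  refine Finset.sum_congr rfl fun a _ => ?_
  rw [integral_finsetSum _ fun b _ => (integrable_conjTwoCopies_apply p Z a b).mul_const _]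
  refine Finset.sum_congr rfl fun b _ => ?_
  rw [integral_mul_const, secondMoment_apply]

/-- Conjugation by `C` passes under the integral and turns `U` into `C U`, which left invariance
absorbs. -/
theorem conjTwoCopies_secondMoment (p : Measure (Matrix.unitaryGroup q ℂ)) [IsFiniteMeasure p]
    {C : Matrix.unitaryGroup q ℂ} (hC : p.map (C * ·) = p) (Z : Matrix (q × q) (q × q) ℂ) :
    conjTwoCopies C.1 (secondMoment p Z) = secondMoment p Z := by
  ext a b
  let l : Matrix (q × q) (q × q) ℂ →ₗ[ℂ] ℂ :=
    { toFun := fun W => conjTwoCopies C.1 W a b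
      map_add' := fun W W' => by simp [conjTwoCopies, Matrix.mul_add, Matrix.add_mul]
      map_smul' := fun c W => by simp [conjTwoCopies] }
  have h := linearMap_secondMoment p l Z
  change conjTwoCopies C.1 (secondMoment p Z) a b = _ at h
  rw [h, secondMoment_apply]
  conv_rhs => rw [← hC]
  rw [integral_map (by fun_prop)
    ((continuous_conjTwoCopies Z).matrix_elem a b).aestronglyMeasurable]
  refine integral_congr_ae (Filter.Eventually.of_forall fun U => ?_)
  exact (congrFun (congrFun (conjTwoCopies_mul C.1 U.1 Z) a) b).symm

theorem kronecker_self_mul_swapOp (U : Matrix q q ℂ) : (U ⊗ₖ U) * swapOp q = swapOp q * (U ⊗ₖ U)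
    := by
  ext ⟨x, x'⟩ ⟨y, y'⟩
  simp [Matrix.mul_apply, swapOp, Fintype.sum_prod_type, ite_and, mul_comm]

theorem conjTranspose_kronecker_self_mul (U : Matrix.unitaryGroup q ℂ) :
    (U.1 ⊗ₖ U.1).conjTranspose * (U.1 ⊗ₖ U.1) = 1 := by
  have hu : U.1.conjTranspose * U.1 = 1 := Matrix.mem_unitaryGroup_iff'.mp U.2
  rw [Matrix.conjTranspose_kronecker, ← Matrix.mul_kronecker_mul, hu, Matrix.one_kronecker_one]

theorem trace_conjTwoCopies_mul_swapOp (U : Matrix.unitaryGroup q ℂ)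
    (Z : Matrix (q × q) (q × q) ℂ) :
    (conjTwoCopies U.1 Z * swapOp q).trace = (Z * swapOp q).trace := by
  have h : (U.1 ⊗ₖ U.1).conjTranspose * swapOp q * (U.1 ⊗ₖ U.1) = swapOp q := by
    rw [Matrix.mul_assoc, ← kronecker_self_mul_swapOp, ← Matrix.mul_assoc,
      conjTranspose_kronecker_self_mul, Matrix.one_mul]
  rw [conjTwoCopies, Matrix.mul_assoc, Matrix.mul_assoc, Matrix.trace_mul_comm, Matrix.mul_assoc, h]

theorem trace_conjTwoCopies (U : Matrix.unitaryGroup q ℂ) (Z : Matrix (q × q) (q × q) ℂ) :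
    (conjTwoCopies U.1 Z).trace = Z.trace := by
  rw [conjTwoCopies, Matrix.mul_assoc, Matrix.trace_mul_comm, Matrix.mul_assoc,
    conjTranspose_kronecker_self_mul, Matrix.mul_one]

theorem linearMap_secondMoment_of_invariant (p : Measure (Matrix.unitaryGroup q ℂ))
    [IsProbabilityMeasure p] (l : Matrix (q × q) (q × q) ℂ →ₗ[ℂ] ℂ) (Z : Matrix (q × q) (q × q) ℂ)
    (hl : ∀ U : Matrix.unitaryGroup q ℂ, l (conjTwoCopies U.1 Z) = l Z) :
    l (secondMoment p Z) = l Z := by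
  rw [linearMap_secondMoment]
  simp [hl]

theorem mul_eq_mul_of_conjTwoCopies_eq {C : Matrix.unitaryGroup q ℂ} {Z : Matrix (q × q) (q × q) ℂ}
    (h : conjTwoCopies C.1 Z = Z) : (C.1 ⊗ₖ C.1) * Z = Z * (C.1 ⊗ₖ C.1) := by
  conv_rhs => rw [← h]
  rw [conjTwoCopies, Matrix.mul_assoc _ _ (C.1 ⊗ₖ C.1), conjTranspose_kronecker_self_mul,
    Matrix.mul_one]

end SecondMoment

/-! ### The phase, Hadamard and controlled-`Z` gates are Clifford. -/

section CliffordGates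

/-- Conjugation by `u` maps Pauli matrices to Pauli matrices, up to a power of `i`. -/
def MapsPauli (u : Matrix (Fin 2) (Fin 2) ℂ) : Prop :=
  ∀ a, ∃ (k : Fin 4) (b : Fin 4), u * pauli a * u.conjTranspose = Complex.I ^ (k : ℕ) • pauli b

/-- The phase gate. -/
def phaseMatrix : Matrix (Fin 2) (Fin 2) ℂ := !![1, 0; 0, Complex.I]

/-- The Hadamard gate. -/
noncomputable def hadamardMatrix : Matrix (Fin 2) (Fin 2) ℂ := ((√2 : ℝ) : ℂ)⁻¹ • !![1, 1; 1, -1]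

theorem sqrt_two_inv_mul_self : ((√2 : ℝ) : ℂ)⁻¹ * ((√2 : ℝ) : ℂ)⁻¹ = 1 / 2 := by
  rw [← mul_inv, ← Complex.ofReal_mul, Real.mul_self_sqrt (by norm_num)]
  norm_num

theorem conjTranspose_hadamardMatrix : hadamardMatrix.conjTranspose = hadamardMatrix := by
  rw [hadamardMatrix, Matrix.conjTranspose_smul]
  congr 1
  · simp
  · ext i j; fin_cases i <;> fin_cases j <;> simp

theorem hadamardMatrix_mul_mul (A : Matrix (Fin 2) (Fin 2) ℂ) :
    hadamardMatrix * A * hadamardMatrix =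
      (1 / 2 : ℂ) • (!![1, 1; 1, -1] * A * !![1, 1; 1, -1]) := by
  rw [hadamardMatrix, Matrix.smul_mul, Matrix.smul_mul, Matrix.mul_smul, smul_smul,
    sqrt_two_inv_mul_self]

theorem hadamardMatrix_mem : hadamardMatrix ∈ Matrix.unitaryGroup (Fin 2) ℂ := by
  rw [Matrix.mem_unitaryGroup_iff, Matrix.star_eq_conjTranspose, conjTranspose_hadamardMatrix]
  have h := hadamardMatrix_mul_mul 1
  rw [Matrix.mul_one] at h
  rw [h]
  ext i j
  fin_cases i <;> fin_cases j <;> norm_num [Matrix.mul_apply, Fin.sum_univ_two]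

theorem phaseMatrix_mem : phaseMatrix ∈ Matrix.unitaryGroup (Fin 2) ℂ := by
  rw [Matrix.mem_unitaryGroup_iff, Matrix.star_eq_conjTranspose]
  ext i j
  fin_cases i <;> fin_cases j <;> simp [phaseMatrix, Matrix.mul_apply, Fin.sum_univ_two]

theorem mapsPauli_one : MapsPauli 1 := fun a => ⟨0, a, by simp⟩

theorem mapsPauli_hadamardMatrix : MapsPauli hadamardMatrix := by
  intro a
  refine ⟨![0, 0, 2, 0] a, ![0, 3, 2, 1] a, ?_⟩
  rw [conjTranspose_hadamardMatrix, hadamardMatrix_mul_mul]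
  ext i j
  fin_cases a <;> fin_cases i <;> fin_cases j <;>
    simp [pauli] <;> norm_num <;> ring

theorem mapsPauli_phaseMatrix : MapsPauli phaseMatrix := by
  intro a
  refine ⟨![0, 0, 2, 0] a, ![0, 2, 1, 3] a, ?_⟩
  ext i j
  fin_cases a <;> fin_cases i <;> fin_cases j <;>
    simp [pauli, phaseMatrix, Matrix.mul_apply, Fin.sum_univ_two]

theorem mapsPauli_conjTranspose_phaseMatrix : MapsPauli phaseMatrix.conjTranspose := by
  intro a
  refine ⟨![0, 2, 0, 0] a, ![0, 2, 1, 3] a, ?_⟩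
  ext i j
  fin_cases a <;> fin_cases i <;> fin_cases j <;>
    simp [pauli, phaseMatrix, Matrix.mul_apply, Fin.sum_univ_two]

theorem smul_pauli_mem (k : ℕ) (a b : Fin 4) :
    Complex.I ^ k • (pauli a ⊗ₖ pauli b) ∈ pauliGroup₂ := by
  refine ⟨(⟨k % 4, Nat.mod_lt _ (by norm_num)⟩, a, b), ?_⟩
  simp only
  rw [Complex.I_pow_eq_pow_mod k]

theorem kronecker_conj_mem {u v : Matrix (Fin 2) (Fin 2) ℂ} (hu : MapsPauli u) (hv : MapsPauli v)
    {A : Matrix (Fin 2 × Fin 2) (Fin 2 × Fin 2) ℂ} (hA : A ∈ pauliGroup₂) :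
    (u ⊗ₖ v) * A * (u ⊗ₖ v).conjTranspose ∈ pauliGroup₂ := by
  obtain ⟨⟨k, a, b⟩, rfl⟩ := hA
  obtain ⟨ku, a', ha⟩ := hu a
  obtain ⟨kv, b', hb⟩ := hv b
  have : (u ⊗ₖ v) * (Complex.I ^ (k : ℕ) • (pauli a ⊗ₖ pauli b)) * (u ⊗ₖ v).conjTranspose =
      Complex.I ^ ((k : ℕ) + ku + kv) • (pauli a' ⊗ₖ pauli b') := by
    rw [Matrix.mul_smul, Matrix.smul_mul, Matrix.conjTranspose_kronecker, ←
        Matrix.mul_kronecker_mul,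
      ← Matrix.mul_kronecker_mul, ha, hb, Matrix.smul_kronecker, Matrix.kronecker_smul, smul_smul,
      smul_smul, pow_add, pow_add, mul_assoc]
  simp only
  rw [this]
  exact smul_pauli_mem _ _ _

/-- A product of two single-qubit gates. -/
def localGate (u v : Matrix.unitaryGroup (Fin 2) ℂ) : Matrix.unitaryGroup (Fin 2 × Fin 2) ℂ :=
  ⟨u.1 ⊗ₖ v.1, by
    have hu : u.1 * u.1.conjTranspose = 1 := Matrix.mem_unitaryGroup_iff.mp u.2
    have hv : v.1 * v.1.conjTranspose = 1 := Matrix.mem_unitaryGroup_iff.mp v.2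
    rw [Matrix.mem_unitaryGroup_iff, Matrix.star_eq_conjTranspose, Matrix.conjTranspose_kronecker,
      ← Matrix.mul_kronecker_mul, hu, hv, Matrix.one_kronecker_one]⟩

theorem localGate_mem {u v : Matrix.unitaryGroup (Fin 2) ℂ} (hu : MapsPauli u.1)
    (hu' : MapsPauli u.1.conjTranspose) (hv : MapsPauli v.1) (hv' : MapsPauli v.1.conjTranspose) :
    localGate u v ∈ cliffordGroup₂ := by
  intro A hA
  refine ⟨kronecker_conj_mem hu hv hA, ?_⟩
  have h := kronecker_conj_mem hu' hv' hA
  rw [← Matrix.conjTranspose_kronecker, Matrix.conjTranspose_conjTranspose] at h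
  exact h

/-- The phases of the controlled-`Z` gate. -/
def czPhase (x : Fin 2 × Fin 2) : ℂ := if x = (1, 1) then -1 else 1

/-- The controlled-`Z` gate. -/
def czGate : Matrix.unitaryGroup (Fin 2 × Fin 2) ℂ :=
  ⟨Matrix.diagonal czPhase, by
    rw [Matrix.mem_unitaryGroup_iff, Matrix.star_eq_conjTranspose, Matrix.diagonal_conjTranspose,
      Matrix.diagonal_mul_diagonal, ← Matrix.diagonal_one]
    congr 1
    ext x
    simp only [czPhase, Pi.star_apply]
    split_ifs <;> simp⟩

theorem conjTranspose_czGate : czGate.1.conjTranspose = czGate.1 := by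
  rw [czGate, Matrix.diagonal_conjTranspose]
  congr 1
  ext x
  simp only [czPhase, Pi.star_apply]
  split_ifs <;> simp

theorem czGate_conj_pauli (a b : Fin 4) :
    czGate.1 * (pauli a ⊗ₖ pauli b) * czGate.1 ∈ pauliGroup₂ := by
  -- Conjugation by controlled-`Z` multiplies an `X` or `Y` on one qubit by a `Z` on the other; only
  -- `X ⊗ Y` and `Y ⊗ X` acquire a sign (exponent 2).
  have h : czGate.1 * (pauli a ⊗ₖ pauli b) * czGate.1 =
      Complex.I ^ (![![0, 0, 0, 0], ![0, 0, 2, 0], ![0, 2, 0, 0], ![0, 0, 0, 0]] a b : ℕ) •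
        (pauli (![![0, 3, 3, 0], ![1, 2, 2, 1], ![2, 1, 1, 2], ![3, 0, 0, 3]] a b) ⊗ₖ
          pauli (![![0, 1, 2, 3], ![3, 2, 1, 0], ![3, 2, 1, 0], ![0, 1, 2, 3]] a b)) := by
    ext ⟨x, x'⟩ ⟨y, y'⟩
    simp only [czGate, Matrix.diagonal_mul, Matrix.mul_diagonal, Matrix.smul_apply,
      Matrix.kroneckerMap_apply, smul_eq_mul, czPhase]
    fin_cases a <;> fin_cases b <;> fin_cases x <;> fin_cases x' <;> fin_cases y <;>
      fin_cases y' <;> simp [pauli]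
  rw [h]
  exact smul_pauli_mem _ _ _

theorem czGate_mem : czGate ∈ cliffordGroup₂ := by
  have h : ∀ A ∈ pauliGroup₂, czGate.1 * A * czGate.1 ∈ pauliGroup₂ := by
    rintro _ ⟨⟨k, a, b⟩, rfl⟩
    obtain ⟨⟨k', a', b'⟩, h⟩ := czGate_conj_pauli a b
    simp only at h ⊢
    rw [Matrix.mul_smul, Matrix.smul_mul, ← h, smul_smul, ← pow_add]
    exact smul_pauli_mem _ _ _
  intro A hA
  rw [Matrix.star_eq_conjTranspose, conjTranspose_czGate]
  exact ⟨h A hA, h A hA⟩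

end CliffordGates

/-! ### The two-copy commutant of the Clifford group and the resulting 2-design formula. -/

section Commutant

/-- Commuting with the phase gate leaves only the six entries that preserve the number of ones; the
Hadamard gate ties these to two free parameters, read off at the points `permPoint`. -/
theorem one_qubit_commutant {W : Matrix (Fin 2 × Fin 2) (Fin 2 × Fin 2) ℂ}
    (hS : (phaseMatrix ⊗ₖ phaseMatrix) * W = W * (phaseMatrix ⊗ₖ phaseMatrix))
    (hH : (hadamardMatrix ⊗ₖ hadamardMatrix) * W = W * (hadamardMatrix ⊗ₖ hadamardMatrix))
    (x y : Fin 2 × Fin 2) :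
    W x y = ∑ s, permState s (x, y) * W (permPoint s).1 (permPoint s).2 := by
  have hS' : ∀ x y : Fin 2 × Fin 2, ((if x.1 = 0 then 1 else Complex.I) *
      (if x.2 = 0 then 1 else Complex.I) - (if y.1 = 0 then 1 else Complex.I) *
      (if y.2 = 0 then 1 else Complex.I)) * W x y = 0 := by
    intro x y
    have hd : phaseMatrix = Matrix.diagonal fun x => if x = 0 then 1 else Complex.I := by
      ext i j; fin_cases i <;> fin_cases j <;> simp [phaseMatrix]
    rw [hd, Matrix.diagonal_kronecker_diagonal] at hS
    have h := congrFun (congrFun hS x) y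
    rw [Matrix.diagonal_mul, Matrix.mul_diagonal] at h
    linear_combination h
  have hI1 : (1 : ℂ) - Complex.I ≠ 0 := fun h => by simpa using congrArg Complex.im h
  have hI2 : Complex.I - (1 : ℂ) ≠ 0 := fun h => by simpa using congrArg Complex.im h
  have hI3 : Complex.I + 1 ≠ 0 := fun h => by simpa using congrArg Complex.im h
  have hI4 : (-1 : ℂ) - Complex.I ≠ 0 := fun h => by simpa using congrArg Complex.im h
  have z1 : W (0, 0) (0, 1) = 0 := by simpa [hI1] using hS' (0, 0) (0, 1)
  have z2 : W (0, 0) (1, 0) = 0 := by simpa [hI1] using hS' (0, 0) (1, 0)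
  have z3 : W (0, 0) (1, 1) = 0 := by simpa using hS' (0, 0) (1, 1)
  have z4 : W (0, 1) (0, 0) = 0 := by simpa [hI2] using hS' (0, 1) (0, 0)
  have z5 : W (0, 1) (1, 1) = 0 := by simpa [hI3] using hS' (0, 1) (1, 1)
  have z6 : W (1, 0) (0, 0) = 0 := by simpa [hI2] using hS' (1, 0) (0, 0)
  have z7 : W (1, 0) (1, 1) = 0 := by simpa [hI3] using hS' (1, 0) (1, 1)
  have z8 : W (1, 1) (0, 0) = 0 := by
    have := hS' (1, 1) (0, 0)
    norm_num at this
    exact this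
  have z9 : W (1, 1) (0, 1) = 0 := by simpa [hI4] using hS' (1, 1) (0, 1)
  have z10 : W (1, 1) (1, 0) = 0 := by simpa [hI4] using hS' (1, 1) (1, 0)
  have hH' : ((!![1, 1; 1, -1] : Matrix (Fin 2) (Fin 2) ℂ) ⊗ₖ !![1, 1; 1, -1]) * W =
      W * ((!![1, 1; 1, -1] : Matrix (Fin 2) (Fin 2) ℂ) ⊗ₖ !![1, 1; 1, -1]) := by
    rw [hadamardMatrix, Matrix.smul_kronecker, Matrix.kronecker_smul, smul_smul,
      sqrt_two_inv_mul_self, Matrix.smul_mul, Matrix.mul_smul] at hH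
    exact smul_right_injective _ (by norm_num : (1 / 2 : ℂ) ≠ 0) hH
  have e1 := congrFun (congrFun hH' (1, 0)) (0, 0)
  have e2 := congrFun (congrFun hH' (0, 1)) (0, 0)
  have e3 := congrFun (congrFun hH' (0, 1)) (0, 1)
  have e4 := congrFun (congrFun hH' (0, 0)) (1, 1)
  have e5 := congrFun (congrFun hH' (0, 0)) (0, 1)
  simp [Matrix.mul_apply, Fintype.sum_prod_type, z1, z2, z3, z4, z5, z6, z7, z8, z9]
    at e1 e2 e3 e4 e5
  obtain ⟨x1, x2⟩ := x
  obtain ⟨y1, y2⟩ := y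
  fin_cases x1 <;> fin_cases x2 <;> fin_cases y1 <;> fin_cases y2 <;>
    simp [permState, permPoint, z1, z2, z3, z4, z5, z6, z7, z8, z9, z10] <;> grind

/-- The entries of an operator on two copies of two qubits, indexed by those of the qubits. -/
def pairEntry (Z : Matrix ((Fin 2 × Fin 2) × (Fin 2 × Fin 2)) ((Fin 2 × Fin 2) × (Fin 2 × Fin 2)) ℂ)
    (p q : TwoCopyIndex) : ℂ :=
  Z ((p.1.1, q.1.1), (p.1.2, q.1.2)) ((p.2.1, q.2.1), (p.2.2, q.2.2))

theorem pairEntry_commute_left {Z : Matrix ((Fin 2 × Fin 2) × (Fin 2 × Fin 2)) _ ℂ}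
    {u : Matrix (Fin 2) (Fin 2) ℂ}
    (h : ((u ⊗ₖ 1) ⊗ₖ (u ⊗ₖ 1)) * Z = Z * ((u ⊗ₖ 1) ⊗ₖ (u ⊗ₖ (1 : Matrix (Fin 2) (Fin 2) ℂ))))
    (q : TwoCopyIndex) :
    (u ⊗ₖ u) * Matrix.of (fun x y => pairEntry Z (x, y) q) =
      Matrix.of (fun x y => pairEntry Z (x, y) q) * (u ⊗ₖ u) := by
  ext x y
  have h' := congrFun (congrFun h ((x.1, q.1.1), (x.2, q.1.2))) ((y.1, q.2.1), (y.2, q.2.2))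
  simpa [Matrix.mul_apply, Fintype.sum_prod_type, Matrix.one_apply, pairEntry] using h'

theorem pairEntry_commute_right {Z : Matrix ((Fin 2 × Fin 2) × (Fin 2 × Fin 2)) _ ℂ}
    {u : Matrix (Fin 2) (Fin 2) ℂ}
    (h : ((1 ⊗ₖ u) ⊗ₖ (1 ⊗ₖ u)) * Z = Z * ((1 ⊗ₖ u) ⊗ₖ ((1 : Matrix (Fin 2) (Fin 2) ℂ) ⊗ₖ u)))
    (p : TwoCopyIndex) :
    (u ⊗ₖ u) * Matrix.of (fun x y => pairEntry Z p (x, y)) =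
      Matrix.of (fun x y => pairEntry Z p (x, y)) * (u ⊗ₖ u) := by
  ext x y
  have h' := congrFun (congrFun h ((p.1.1, x.1), (p.1.2, x.2))) ((p.2.1, y.1), (p.2.2, y.2))
  simpa [Matrix.mul_apply, Fintype.sum_prod_type, Matrix.one_apply, pairEntry] using h'

/-- The commutant of the two-qubit Clifford group on two copies. -/
theorem clifford_commutant {Z : Matrix ((Fin 2 × Fin 2) × (Fin 2 × Fin 2)) _ ℂ}
    (h : ∀ C ∈ cliffordGroup₂, (C.1 ⊗ₖ C.1) * Z = Z * (C.1 ⊗ₖ C.1)) (p q : TwoCopyIndex) :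
    pairEntry Z p q =
      ∑ s, permState s p * permState s q * pairEntry Z (permPoint s) (permPoint s) := by
  let S : Matrix.unitaryGroup (Fin 2) ℂ := ⟨phaseMatrix, phaseMatrix_mem⟩
  let K : Matrix.unitaryGroup (Fin 2) ℂ := ⟨hadamardMatrix, hadamardMatrix_mem⟩
  have h1 : MapsPauli (1 : Matrix (Fin 2) (Fin 2) ℂ).conjTranspose := by
    rw [Matrix.conjTranspose_one]; exact mapsPauli_one
  have hK : MapsPauli hadamardMatrix.conjTranspose := by
    rw [conjTranspose_hadamardMatrix]; exact mapsPauli_hadamardMatrix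
  have hS1 := h _ (localGate_mem (u := S) (v := 1) mapsPauli_phaseMatrix
    mapsPauli_conjTranspose_phaseMatrix mapsPauli_one h1)
  have hS2 := h _ (localGate_mem (u := 1) (v := S) mapsPauli_one h1 mapsPauli_phaseMatrix
    mapsPauli_conjTranspose_phaseMatrix)
  have hH1 := h _ (localGate_mem (u := K) (v := 1) mapsPauli_hadamardMatrix hK mapsPauli_one h1)
  have hH2 := h _ (localGate_mem (u := 1) (v := K) mapsPauli_one h1 mapsPauli_hadamardMatrix hK)
  have hl : ∀ p q, pairEntry Z p q = ∑ s, permState s p * pairEntry Z (permPoint s) q := fun p q =>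
    one_qubit_commutant (pairEntry_commute_left hS1 q) (pairEntry_commute_left hH1 q) p.1 p.2
  have hr : ∀ p q, pairEntry Z p q = ∑ s, permState s q * pairEntry Z p (permPoint s) := fun p q =>
    one_qubit_commutant (pairEntry_commute_right hS2 p) (pairEntry_commute_right hH2 p) q.1 q.2
  have hcz := h _ czGate_mem
  -- Single-qubit gates still allow identity on one qubit with swap on the other. At these entries
  -- the controlled-`Z` phases of row and column are opposite, so they vanish.
  have hz : ∀ s, pairEntry Z (permPoint s) (permPoint !s) = 0 := by
    intro s
    rw [czGate, Matrix.diagonal_kronecker_diagonal] at hcz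
    have e : ∀ x y, czPhase x.1 * czPhase x.2 * Z x y = Z x y * (czPhase y.1 * czPhase y.2) := by
      intro x y
      have := congrFun (congrFun hcz x) y
      rwa [Matrix.diagonal_mul, Matrix.mul_diagonal] at this
    have e1 := e (((permPoint s).1.1, (permPoint !s).1.1), ((permPoint s).1.2, (permPoint !s).1.2))
      (((permPoint s).2.1, (permPoint !s).2.1), ((permPoint s).2.2, (permPoint !s).2.2))
    change _ * pairEntry Z (permPoint s) (permPoint !s) =
      pairEntry Z (permPoint s) (permPoint !s) * _ at e1
    generalize pairEntry Z (permPoint s) (permPoint !s) = w at e1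
    cases s <;> simp [permPoint, czPhase] at e1 <;> linear_combination (-1 / 2 : ℂ) * e1
  rw [hl]
  refine Finset.sum_congr rfl fun s _ => ?_
  rw [hr, mul_assoc]
  congr 1
  cases s
  · simpa using Or.inr (hz false)
  · simpa using Or.inr (hz true)

/-- The trace of an operator on two copies of two qubits against a permutation operator. -/
noncomputable def permTrace (s : Bool) :
    Matrix ((Fin 2 × Fin 2) × (Fin 2 × Fin 2)) ((Fin 2 × Fin 2) × (Fin 2 × Fin 2)) ℂ →ₗ[ℂ] ℂ where
  toFun Z := ∑ p, ∑ q, permState s p * permState s q * pairEntry Z p q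
  map_add' Z W := by simp [pairEntry, mul_add, Finset.sum_add_distrib]
  map_smul' c Z := by
    simp only [pairEntry, Matrix.smul_apply, smul_eq_mul, RingHom.id_apply, Finset.mul_sum]
    exact Finset.sum_congr rfl fun p _ => Finset.sum_congr rfl fun q _ => by ring

theorem permTrace_apply (s : Bool)
    (Z : Matrix ((Fin 2 × Fin 2) × (Fin 2 × Fin 2)) ((Fin 2 × Fin 2) × (Fin 2 × Fin 2)) ℂ) :
    permTrace s Z = ∑ p, ∑ q, permState s p * permState s q * pairEntry Z p q := rfl

theorem permTrace_false
    (Z : Matrix ((Fin 2 × Fin 2) × (Fin 2 × Fin 2)) ((Fin 2 × Fin 2) × (Fin 2 × Fin 2)) ℂ) :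
    permTrace false Z = Z.trace := by
  simp only [permTrace_apply, Matrix.trace, Fintype.sum_prod_type, Fin.sum_univ_two, permState,
    pairEntry, Matrix.diag_apply]
  simp
  ring

theorem permTrace_true
    (Z : Matrix ((Fin 2 × Fin 2) × (Fin 2 × Fin 2)) ((Fin 2 × Fin 2) × (Fin 2 × Fin 2)) ℂ) :
    permTrace true Z = (Z * swapOp (Fin 2 × Fin 2)).trace := by
  simp only [permTrace_apply, Matrix.trace, Fintype.sum_prod_type, Fin.sum_univ_two, permState,
    pairEntry, Matrix.diag_apply, Matrix.mul_apply, swapOp, Matrix.of_apply]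
  simp
  ring

theorem permTrace_conjTwoCopies (s : Bool) (U : Matrix.unitaryGroup (Fin 2 × Fin 2) ℂ)
    (Z : Matrix ((Fin 2 × Fin 2) × (Fin 2 × Fin 2)) ((Fin 2 × Fin 2) × (Fin 2 × Fin 2)) ℂ) :
    permTrace s (conjTwoCopies U.1 Z) = permTrace s Z := by
  cases s
  · rw [permTrace_false, permTrace_false, trace_conjTwoCopies]
  · rw [permTrace_true, permTrace_true, trace_conjTwoCopies_mul_swapOp]

/-- The second-moment operator of a Clifford-invariant measure is that of a unitary 2-design. -/
theorem pairEntry_secondMoment {ν : Measure (Matrix.unitaryGroup (Fin 2 × Fin 2) ℂ)}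
    [IsProbabilityMeasure ν] (hν : ∀ C ∈ cliffordGroup₂, ν.map (C * ·) = ν)
    (Z : Matrix ((Fin 2 × Fin 2) × (Fin 2 × Fin 2)) ((Fin 2 × Fin 2) × (Fin 2 × Fin 2)) ℂ)
    (p q : TwoCopyIndex) :
    pairEntry (secondMoment ν Z) p q = ∑ s, ∑ t, (if s = t then (4 / 60 : ℂ) else -1 / 60) *
      (permState s p * permState s q * permTrace t Z) := by
  set Y := secondMoment ν Z with hY
  obtain ⟨c, hcomm⟩ : ∃ c : Bool → ℂ, ∀ p q, pairEntry Y p q =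
      ∑ s, permState s p * permState s q * c s :=
    ⟨_, clifford_commutant fun C hC =>
      mul_eq_mul_of_conjTwoCopies_eq (conjTwoCopies_secondMoment ν (hν C hC) Z)⟩
  -- The traces of `Z` survive the averaging, so they are the image of `c` under the Gram matrix
  -- with entries 16 and 4, whose inverse supplies the stated coefficients.
  have htr : ∀ t, permTrace t Z =
      ∑ s, (if s = t then 16 else 4) * c s := by
    intro t
    rw [← linearMap_secondMoment_of_invariant ν (permTrace t) Z
      (fun U => permTrace_conjTwoCopies t U Z), ← hY, permTrace_apply]
    simp only [hcomm, Finset.mul_sum]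
    refine ((Finset.sum_congr rfl fun p _ => Finset.sum_comm).trans Finset.sum_comm).trans ?_
    refine Finset.sum_congr rfl fun s _ => ?_
    have : (if s = t then 16 else 4 : ℂ) =
        (∑ p, permState s p * permState t p) * ∑ q, permState s q * permState t q := by
      rw [sum_permState_mul]; split_ifs <;> norm_num
    rw [this, Finset.sum_mul_sum, Finset.sum_mul]
    refine Finset.sum_congr rfl fun p _ => ?_
    rw [Finset.sum_mul]
    exact Finset.sum_congr rfl fun q _ => by ring
  rw [hcomm]
  simp only [htr, Fintype.sum_bool]
  simp
  ring

end Commutant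

/-! ### Both gate distributions are Clifford-invariant. -/

section Invariance

theorem haarGate_map_mul (C : Matrix.unitaryGroup (Fin 2 × Fin 2) ℂ) :
    haarGate.map (C * ·) = haarGate := by
  unfold haarGate
  exact map_mul_left_eq_self _ C

theorem cliffordGate_map_mul {C : Matrix.unitaryGroup (Fin 2 × Fin 2) ℂ}
    (hC : C ∈ cliffordGroup₂) : cliffordGate.map (C * ·) = cliffordGate := by
  have hm : Measurable fun U : Matrix.unitaryGroup (Fin 2 × Fin 2) ℂ => C * U :=
    (continuous_const.mul continuous_id).measurable
  have hm' : Measurable fun U : cliffordGroup₂ => (⟨C, hC⟩ : cliffordGroup₂) * U :=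
    (continuous_const.mul continuous_id).measurable
  rw [cliffordGate, Measure.map_map hm measurable_subtype_coe]
  conv_rhs => rw [← map_mul_left_eq_self (Measure.haarMeasure _) (⟨C, hC⟩ : cliffordGroup₂),
    Measure.map_map measurable_subtype_coe hm']
  rfl

end Invariance

/-! ### The circuit's second-moment operator as an average of pair projections. -/

section Circuit

theorem conjTwoCopies_apply {q : Type*} [Fintype q] (U : Matrix q q ℂ)
    (Z : Matrix (q × q) (q × q) ℂ) (x x' y y' : q) :
    conjTwoCopies U Z (x, x') (y, y') = ∑ z, U x z * ∑ z', U x' z' * ∑ w, star (U y w) *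
      ∑ w', star (U y' w') * Z (z, z') (w, w') := by
  rw [conjTwoCopies, Matrix.mul_assoc]
  simp only [Matrix.mul_apply, Matrix.conjTranspose_apply, Matrix.kroneckerMap_apply,
    Fintype.sum_prod_type, Finset.mul_sum, star_mul']
  refine Finset.sum_congr rfl fun z _ => Finset.sum_congr rfl fun z' _ =>
    Finset.sum_congr rfl fun w _ => Finset.sum_congr rfl fun w' _ => ?_
  ring

variable {V : Type*} [DecidableEq V]

/-- `splitPair` as an equivalence. -/
noncomputable def splitPairEquiv {i j : V} (h : i ≠ j) :
    (V → Fin 2) ≃ (Fin 2 × Fin 2) × ({k : V // k ≠ i ∧ k ≠ j} → Fin 2) :=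
  Equiv.ofBijective _ (splitPair_bijective h)

theorem splitPairEquiv_symm_apply {i j : V} (h : i ≠ j) (c : Fin 2 × Fin 2) (x : V → Fin 2) :
    (splitPairEquiv h).symm (c, (splitPair i j x).2) =
      Function.update (Function.update x i c.1) j c.2 := by
  rw [Equiv.symm_apply_eq]
  change _ = splitPair i j _
  simp only [splitPair, Function.update_self, Function.update_of_ne h]
  refine Prod.ext rfl ?_
  funext k
  simp [k.2.1, k.2.2]

variable [Fintype V]

theorem sum_onPair_mul {i j : V} (h : i ≠ j) (u : Matrix.unitaryGroup (Fin 2 × Fin 2) ℂ)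
    (x : V → Fin 2) (F : (V → Fin 2) → ℂ) :
    ∑ z, (onPair h u).1 x z * F z = ∑ c, u.1 (x i, x j) c *
      F (Function.update (Function.update x i c.1) j c.2) := by
  rw [← (splitPairEquiv h).symm.sum_comp, Fintype.sum_prod_type]
  refine Finset.sum_congr rfl fun c _ => ?_
  rw [Finset.sum_eq_single (splitPair i j x).2]
  · rw [splitPairEquiv_symm_apply]
    congr 1
    simp only [onPair, Matrix.submatrix_apply, Matrix.kroneckerMap_apply]
    rw [← splitPairEquiv_symm_apply h c x]
    have : splitPair i j ((splitPairEquiv h).symm (c, (splitPair i j x).2)) =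
      (c, (splitPair i j x).2) := (splitPairEquiv h).apply_symm_apply _
    rw [this, Matrix.one_apply_eq, mul_one]
    rfl
  · intro r _ hr
    have : splitPair i j ((splitPairEquiv h).symm (c, r)) = (c, r) :=
      (splitPairEquiv h).apply_symm_apply _
    simp only [onPair, Matrix.submatrix_apply, Matrix.kroneckerMap_apply, this]
    rw [Matrix.one_apply_ne (Ne.symm hr)]
    simp
  · simp

theorem sum_star_onPair_mul {i j : V} (h : i ≠ j) (u : Matrix.unitaryGroup (Fin 2 × Fin 2) ℂ)
    (x : V → Fin 2) (F : (V → Fin 2) → ℂ) :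
    ∑ z, star ((onPair h u).1 x z) * F z = ∑ c, star (u.1 (x i, x j) c) *
      F (Function.update (Function.update x i c.1) j c.2) := by
  have h1 := congrArg star (sum_onPair_mul h u x fun z => star (F z))
  simpa only [star_sum, star_mul', star_star] using h1

/-- The part of an operator on two copies of a register that acts on the qubits `i` and `j`, for
given configurations of the other qubits. -/
def pairBlock (i j : V) (Z : Matrix ((V → Fin 2) × (V → Fin 2)) ((V → Fin 2) × (V → Fin 2)) ℂ)
    (a b : (V → Fin 2) × (V → Fin 2)) :
    Matrix ((Fin 2 × Fin 2) × (Fin 2 × Fin 2)) ((Fin 2 × Fin 2) × (Fin 2 × Fin 2)) ℂ :=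
  Matrix.of fun c d =>
    Z (Function.update (Function.update a.1 i c.1.1) j c.1.2,
        Function.update (Function.update a.2 i c.2.1) j c.2.2)
      (Function.update (Function.update b.1 i d.1.1) j d.1.2,
        Function.update (Function.update b.2 i d.2.1) j d.2.2)

/-- The other qubits are spectators, so each entry is one of a conjugation on two qubits, to which
the 2-design formula applies. -/
theorem conjTwoCopies_onPair {i j : V} (h : i ≠ j) (u : Matrix.unitaryGroup (Fin 2 × Fin 2) ℂ)
    (Z : Matrix ((V → Fin 2) × (V → Fin 2)) ((V → Fin 2) × (V → Fin 2)) ℂ)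
    (a b : (V → Fin 2) × (V → Fin 2)) :
    conjTwoCopies (onPair h u).1 Z a b = conjTwoCopies u.1 (pairBlock i j Z a b)
      ((a.1 i, a.1 j), (a.2 i, a.2 j)) ((b.1 i, b.1 j), (b.2 i, b.2 j)) := by
  obtain ⟨x, x'⟩ := a
  obtain ⟨y, y'⟩ := b
  rw [conjTwoCopies_apply, conjTwoCopies_apply]
  simp only [sum_onPair_mul, sum_star_onPair_mul]
  rfl

theorem continuous_onPair {i j : V} (h : i ≠ j) : Continuous (onPair h) := by
  refine Continuous.subtype_mk ?_ _
  refine continuous_matrix fun x y => ?_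
  exact (continuous_subtype_val.matrix_elem _ _).mul continuous_const

theorem secondMoment_circuitStep_apply (G : SimpleGraph V) [DecidableRel G.Adj]
    (ν : Measure (Matrix.unitaryGroup (Fin 2 × Fin 2) ℂ)) [IsFiniteMeasure ν]
    (Z : Matrix ((V → Fin 2) × (V → Fin 2)) ((V → Fin 2) × (V → Fin 2)) ℂ)
    (a b : (V → Fin 2) × (V → Fin 2)) :
    secondMoment (circuitStep G ν) Z a b = (Fintype.card G.Dart : ℂ)⁻¹ * ∑ e : G.Dart,
      secondMoment ν (pairBlock e.fst e.snd Z a b)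
        ((a.1 e.fst, a.1 e.snd), (a.2 e.fst, a.2 e.snd))
        ((b.1 e.fst, b.1 e.snd), (b.2 e.fst, b.2 e.snd)) := by
  rw [secondMoment_apply]
  unfold circuitStep
  rw [integral_smul_nnreal_measure,
    integral_finsetSum_measure fun e _ => integrable_conjTwoCopies_apply _ Z a b]
  rw [NNReal.smul_def, Complex.real_smul]
  congr 1
  · simp
  · refine Finset.sum_congr rfl fun e _ => ?_
    rw [integral_map (continuous_onPair e.adj.ne).measurable.aemeasurable
      ((continuous_conjTwoCopies Z).matrix_elem a b).aestronglyMeasurable, secondMoment_apply]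
    exact integral_congr_ae (Filter.Eventually.of_forall fun u =>
      conjTwoCopies_onPair e.adj.ne u Z a b)

/-- The operators on two copies of a register of qubits, as the tensor product over the qubits of
the operators on two copies of a qubit. -/
noncomputable def toTensor :
    Matrix ((V → Fin 2) × (V → Fin 2)) ((V → Fin 2) × (V → Fin 2)) ℂ ≃ₗ[ℂ]
      EuclideanSpace ℂ (V → TwoCopyIndex) where
  toFun Z := WithLp.toLp 2 fun y =>
    Z (fun k => (y k).1.1, fun k => (y k).1.2) (fun k => (y k).2.1, fun k => (y k).2.2)
  map_add' _ _ := rfl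
  map_smul' _ _ := rfl
  invFun f := Matrix.of fun a b => f fun k => ((a.1 k, a.2 k), (b.1 k, b.2 k))
  left_inv _ := rfl
  right_inv _ := rfl

theorem toTensor_apply (Z : Matrix ((V → Fin 2) × (V → Fin 2)) ((V → Fin 2) × (V → Fin 2)) ℂ)
    (y : V → TwoCopyIndex) : toTensor Z y =
      Z (fun k => (y k).1.1, fun k => (y k).1.2) (fun k => (y k).2.1, fun k => (y k).2.2) := rfl

theorem toTensor_one : toTensor (V := V) 1 = globalState false := by
  ext y
  rw [toTensor_apply]
  simp only [globalState, permState, Matrix.one_apply, cond_false]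
  rw [Finset.prod_ite_zero]
  simp only [Prod.ext_iff, funext_iff, Finset.mem_univ, true_implies, Finset.prod_const_one,
    forall_and]

theorem toTensor_swapOp : toTensor (swapOp (V → Fin 2)) = globalState true := by
  ext y
  rw [toTensor_apply]
  simp only [globalState, permState, swapOp, Matrix.of_apply, cond_true]
  rw [Finset.prod_ite_zero]
  simp only [Prod.ext_iff, funext_iff, Finset.mem_univ, true_implies, Finset.prod_const_one,
    forall_and, Prod.fst_swap, Prod.snd_swap]

theorem pairProj_apply (i j : V) (h : i ≠ j) (f : EuclideanSpace ℂ (V → TwoCopyIndex))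
    (y : V → TwoCopyIndex) :
    pairProj i j f y = ∑ s, ∑ t, (if s = t then (4 / 60 : ℂ) else -1 / 60) *
      (permState s (y i) * permState s (y j) * ∑ p, ∑ q, permState t p * permState t q *
        f (Function.update (Function.update y i p) j q)) := by
  simp only [pairProj, LinearMap.sum_apply, LinearMap.smul_apply, PiLp.smul_apply, smul_eq_mul,
    WithLp.ofLp_sum, Finset.sum_apply, Module.End.mul_apply, permOp, siteOp_apply,
    Function.update_of_ne h.symm]
  refine Finset.sum_congr rfl fun s _ => Finset.sum_congr rfl fun t _ => ?_
  congr 1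
  rw [mul_assoc, Finset.mul_sum (a := permState s (y j))]
  congr 1
  refine Finset.sum_congr rfl fun p _ => ?_
  simp only [Finset.mul_sum]
  exact Finset.sum_congr rfl fun q _ => by ring

theorem pairEntry_pairBlock (i j : V)
    (Z : Matrix ((V → Fin 2) × (V → Fin 2)) ((V → Fin 2) × (V → Fin 2)) ℂ)
    (y : V → TwoCopyIndex) (p q : TwoCopyIndex) :
    pairEntry (pairBlock i j Z (fun k => (y k).1.1, fun k => (y k).1.2)
      (fun k => (y k).2.1, fun k => (y k).2.2)) p q =
      toTensor Z (Function.update (Function.update y i p) j q) := by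
  rw [toTensor_apply]
  simp only [pairEntry, pairBlock, Matrix.of_apply]
  have e : ∀ (g : TwoCopyIndex → Fin 2), (fun k => g (Function.update (Function.update y i p) j q
      k)) =
      Function.update (Function.update (fun k => g (y k)) i (g p)) j (g q) := by
    intro g
    funext k
    by_cases hj : k = j
    · subst hj; simp
    · by_cases hi : k = i
      · subst hi; simp [hj]
      · simp [hi, hj]
  rw [e fun x => x.1.1, e fun x => x.1.2, e fun x => x.2.1, e fun x => x.2.2]

theorem toTensor_secondMoment_circuitStep (G : SimpleGraph V) [DecidableRel G.Adj]
    {ν : Measure (Matrix.unitaryGroup (Fin 2 × Fin 2) ℂ)} [IsProbabilityMeasure ν]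
    (hν : ∀ C ∈ cliffordGroup₂, ν.map (C * ·) = ν)
    (Z : Matrix ((V → Fin 2) × (V → Fin 2)) ((V → Fin 2) × (V → Fin 2)) ℂ) :
    toTensor (secondMoment (circuitStep G ν) Z) =
      (Fintype.card G.Dart : ℂ)⁻¹ • ∑ e : G.Dart, pairProj e.fst e.snd (toTensor Z) := by
  ext y
  rw [toTensor_apply, secondMoment_circuitStep_apply]
  simp only [PiLp.smul_apply, WithLp.ofLp_sum, Finset.sum_apply, smul_eq_mul]
  congr 1
  refine Finset.sum_congr rfl fun e _ => ?_
  have h := pairEntry_secondMoment hν (pairBlock e.fst e.snd Z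
    (fun k => (y k).1.1, fun k => (y k).1.2) (fun k => (y k).2.1, fun k => (y k).2.2))
    (y e.fst) (y e.snd)
  rw [pairProj_apply _ _ e.adj.ne]
  simp only [permTrace_apply, pairEntry_pairBlock] at h
  exact h

end Circuit

/-! ### A Hamiltonian path in the box, and a count of its darts. -/

section Lattice

theorem latticeBox_adj_cons_head {d : ℕ} {L : Fin (d + 1) → ℕ} {a b : Fin (L 0)}
    (h : (SimpleGraph.pathGraph (L 0)).Adj a b) (x : (i : Fin d) → Fin (L i.succ)) :
    (latticeBox L).Adj (Fin.cons (α := fun i => Fin (L i)) a x)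
      (Fin.cons (α := fun i => Fin (L i)) b x) := by
  refine ⟨0, by simpa using h, fun j hj => ?_⟩
  obtain ⟨j, rfl⟩ := Fin.exists_succ_eq.mpr hj
  simp

theorem latticeBox_adj_cons_tail {d : ℕ} {L : Fin (d + 1) → ℕ} (a : Fin (L 0))
    {x y : (i : Fin d) → Fin (L i.succ)} (h : (latticeBox fun i : Fin d => L i.succ).Adj x y) :
    (latticeBox L).Adj (Fin.cons (α := fun i => Fin (L i)) a x)
      (Fin.cons (α := fun i => Fin (L i)) a y) := by
  obtain ⟨i, hi, hj⟩ := h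
  refine ⟨i.succ, by simpa using hi, fun j hne => ?_⟩
  cases j using Fin.cases with
  | zero => simp
  | succ j => simpa using hj j fun e => hne (e ▸ rfl)

/-- The snake through all sites of a box. -/
theorem exists_path_through_latticeBox {d : ℕ} (L : Fin d → ℕ) (hL : ∀ i, 0 < L i) :
    ∃ c : ℕ → (i : Fin d) → Fin (L i),
      (∀ k, k + 1 < ∏ i, L i → (latticeBox L).Adj (c k) (c (k + 1))) ∧
        ∀ v, ∃ k < ∏ i, L i, c k = v := by
  induction d with
  | zero => exact ⟨fun _ i => i.elim0, by simp, fun v => ⟨0, by simp, Subsingleton.elim _ _⟩⟩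
  | succ d ih =>
    obtain ⟨c, hadj, hsurj⟩ := ih (fun i => L i.succ) fun i => hL _
    rw [Fin.prod_univ_succ]
    have hN : 0 < ∏ i : Fin d, L i.succ := Finset.prod_pos fun i _ => hL _
    generalize ∏ i : Fin d, L i.succ = N at *
    have hdiv : ∀ a r, r < N → (a * N + r) / N = a := fun a r hr => by
      rw [mul_comm, Nat.mul_add_div hN, Nat.div_eq_of_lt hr, add_zero]
    have hmod : ∀ a r, r < N → (a * N + r) % N = r := fun a r hr => by
      rw [mul_comm, Nat.mul_add_mod, Nat.mod_eq_of_lt hr]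
    -- The layers of the first coordinate are traversed alternately forwards and backwards.
    let p : ℕ → ℕ → ℕ := fun a r => if Even a then r else N - 1 - r
    let f : ℕ → (i : Fin (d + 1)) → Fin (L i) := fun k =>
      Fin.cons (α := fun i => Fin (L i)) ⟨k / N % L 0, Nat.mod_lt _ (hL 0)⟩ (c (p (k / N) (k % N)))
    have hf : ∀ a r, (ha : a < L 0) → r < N →
        f (a * N + r) = Fin.cons (α := fun i => Fin (L i)) ⟨a, ha⟩ (c (p a r)) := by
      intro a r ha hr
      simp only [f, hdiv a r hr, hmod a r hr, Nat.mod_eq_of_lt ha]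
    refine ⟨f, fun k hk => ?_, fun v => ?_⟩
    · obtain ⟨a, r, hr, rfl⟩ : ∃ a r, r < N ∧ k = a * N + r :=
        ⟨k / N, k % N, Nat.mod_lt _ hN, (Nat.div_add_mod' k N).symm⟩
      have ha : a < L 0 := by
        by_contra! h
        have := Nat.mul_le_mul_right N h
        omega
      rw [hf a r ha hr]
      by_cases hr' : r + 1 < N
      · rw [add_assoc, hf a (r + 1) ha hr']
        refine latticeBox_adj_cons_tail _ ?_
        by_cases he : Even a
        · simp only [p, if_pos he]
          exact hadj r hr'
        · simp only [p, if_neg he]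
          have h := hadj (N - 1 - (r + 1)) (by omega)
          rw [show N - 1 - (r + 1) + 1 = N - 1 - r by omega] at h
          exact h.symm
      · have e : a * N + r + 1 = (a + 1) * N + 0 := by
          rw [Nat.add_mul]; omega
        have ha' : a + 1 < L 0 := by
          by_contra! h
          have := Nat.mul_le_mul_right N h
          omega
        rw [e, hf (a + 1) 0 ha' hN]
        -- At a turn `r = N - 1`: the next layer starts at the position where the previous one
        -- ended.
        have hp : p (a + 1) 0 = p a r := by
          by_cases he : Even a
          · simp only [p, if_pos he, Nat.even_add_one, not_true, he, if_false]; omega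
          · simp only [p, Nat.even_add_one, he, not_false_iff, if_true, if_false]; omega
        rw [hp]
        refine latticeBox_adj_cons_head ?_ _
        rw [SimpleGraph.pathGraph_adj]
        exact Or.inl rfl
    · obtain ⟨r, hr, hv⟩ := hsurj fun i => v i.succ
      have hpr : p (v 0) r < N := by simp only [p]; split_ifs <;> omega
      refine ⟨v 0 * N + p (v 0) r, ?_, ?_⟩
      · have := Nat.mul_le_mul_right N (Nat.succ_le_of_lt (v 0).2)
        rw [Nat.succ_mul] at this
        omega
      · rw [hf _ _ (v 0).2 hpr]
        have hpp : p (v 0) (p (v 0) r) = r := by simp only [p]; split_ifs <;> omega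
        rw [hpp, hv]
        exact Fin.cons_self_tail v

/-- A dart is determined by its source, the coordinate that changes, and whether it increases. -/
theorem card_dart_latticeBox_le {d : ℕ} (L : Fin d → ℕ) :
    Fintype.card (latticeBox L).Dart ≤ 2 * d * ∏ i, L i := by
  have hex : ∀ e : (latticeBox L).Dart, ∃ i, (SimpleGraph.pathGraph (L i)).Adj (e.fst i) (e.snd i) ∧
      ∀ j, j ≠ i → e.fst j = e.snd j := fun e => e.adj
  choose i hi hj using hex
  let f : (latticeBox L).Dart → ((j : Fin d) → Fin (L j)) × (Fin d × Bool) :=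
    fun e => (e.fst, i e, decide (e.fst (i e) < e.snd (i e)))
  have hf : Function.Injective f := by
    intro e e' h
    simp only [f, Prod.mk.injEq, decide_eq_decide] at h
    obtain ⟨h1, h2, h3⟩ := h
    refine SimpleGraph.Dart.ext _ _ (Prod.ext h1 ?_)
    funext j
    by_cases hji : j = i e
    · have a1 := hi e
      have a2 := hi e'
      rw [SimpleGraph.pathGraph_adj] at a1 a2
      rw [← h2, ← hji] at a2 h3
      rw [← hji] at a1
      rw [← h1] at a2 h3
      rw [Fin.lt_def, Fin.lt_def] at h3
      refine Fin.ext ?_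
      omega
    · rw [← hj e j hji, ← hj e' j (h2 ▸ hji), h1]
  refine (Fintype.card_le_of_injective f hf).trans (le_of_eq ?_)
  simp only [Fintype.card_prod, Fintype.card_pi, Fintype.card_fin, Fintype.card_bool]
  ring

end Lattice

/-! ### Eigenspace and gap on graphs with a Hamiltonian path, and the theorem. -/

section Gap

variable {V : Type*} [Fintype V] [DecidableEq V]

theorem neg_le_two_mul_re_inner_pairProj {i j k : V} (hij : i ≠ j) (hjk : j ≠ k) (hik : i ≠ k)
    (f : EuclideanSpace ℂ (V → TwoCopyIndex)) :
    -(2 / 5) * (‖f - pairProj i j f‖ ^ 2 + ‖f - pairProj j k f‖ ^ 2) ≤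
      2 * (inner ℂ (f - pairProj i j f) (f - pairProj j k f)).re := by
  refine neg_le_two_mul_re_inner (pairProj_isSymmetricProjection hij)
    (pairProj_isSymmetricProjection hjk) (siteProj_isSymmetricProjection k) ?_ ?_ ?_ f
  · intro x
    have h := LinearMap.congr_fun (siteProj_commute_pairProj hik hjk).eq x
    simpa only [Module.End.mul_apply] using h
  · intro x
    have h := LinearMap.congr_fun (siteProj_mul_pairProj_right hjk) x
    simpa only [Module.End.mul_apply] using h
  · intro x
    have h := LinearMap.congr_fun (pairProj_three_site hij hjk hik) x
    simpa only [Module.End.mul_apply, LinearMap.sub_apply, LinearMap.smul_apply] using h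

theorem mem_span_globalState_iff (Z : Matrix ((V → Fin 2) × (V → Fin 2)) ((V → Fin 2) × (V → Fin
    2)) ℂ) :
    toTensor Z ∈ Submodule.span ℂ {globalState false, globalState true} ↔
      Z ∈ Submodule.span ℂ {1, swapOp (V → Fin 2)} := by
  rw [Submodule.mem_span_pair, Submodule.mem_span_pair, ← toTensor_one, ← toTensor_swapOp]
  simp only [← map_smul, ← map_add, toTensor.injective.eq_iff]

/-- One step of a random circuit on a graph with a path through all vertices. -/
theorem eigenspace_and_gap_of_path (G : SimpleGraph V) [DecidableRel G.Adj]
    {ν : Measure (Matrix.unitaryGroup (Fin 2 × Fin 2) ℂ)} [IsProbabilityMeasure ν]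
    (hν : ∀ C ∈ cliffordGroup₂, ν.map (C * ·) = ν) {n : ℕ} (hn : 2 ≤ n) (hcard : Fintype.card V = n)
    {c : ℕ → V} (hadj : ∀ k, k + 1 < n → G.Adj (c k) (c (k + 1))) (hc : ∀ v, ∃ k < n, c k = v) :
    (secondMoment (circuitStep G ν)).eigenspace 1 = Submodule.span ℂ {1, swapOp (V → Fin 2)} ∧
      1 / (5 * Fintype.card G.Dart) ≤ spectralGap (secondMoment (circuitStep G ν)) := by
  have hinj : ∀ k l, k < n → l < n → c k = c l → k = l := by
    have hb : Function.Bijective fun k : Fin n => c k := by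
      rw [Fintype.bijective_iff_surjective_and_card]
      refine ⟨fun v => ?_, by simp [hcard]⟩
      obtain ⟨k, hk, h⟩ := hc v
      exact ⟨⟨k, hk⟩, h⟩
    intro k l hk hl h
    exact congrArg Fin.val (hb.injective (a₁ := ⟨k, hk⟩) (a₂ := ⟨l, hl⟩) h)
  have hne : ∀ k l, k < n → l < n → k ≠ l → c k ≠ c l := fun k l hk hl hkl h =>
    hkl (hinj k l hk hl h)
  -- The path has `n - 1` edges; beyond them the value is a dummy that is never used.
  let dart : ℕ → G.Dart := fun k =>
    if h : k + 1 < n then ⟨(c k, c (k + 1)), hadj k h⟩ else ⟨(c 0, c 1), hadj 0 (by omega)⟩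
  have hdart : ∀ k (h : k + 1 < n), dart k = ⟨(c k, c (k + 1)), hadj k h⟩ := fun k h => dif_pos h
  have : Nonempty G.Dart := ⟨dart 0⟩
  let P : G.Dart → Module.End ℂ (EuclideanSpace ℂ (V → TwoCopyIndex)) :=
    fun e => pairProj e.fst e.snd
  have hPdart : ∀ k, k + 1 < n → P (dart k) = pairProj (c k) (c (k + 1)) := fun k hk => by
    simp only [P, hdart k hk]
  have hP : ∀ e, LinearMap.IsSymmetricProjection (P e) := fun e =>
    pairProj_isSymmetricProjection e.adj.ne
  have hspan : ∀ f, (∀ k < n - 1, P (dart k) f = f) →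
      f ∈ Submodule.span ℂ {globalState false, globalState true} := by
    intro f hf
    refine mem_span_globalState hc hn (fun k hk => (hadj k hk).ne) fun k hk => ?_
    rw [← hPdart k hk]
    exact hf k (by omega)
  have hfixed : ∀ f ∈ Submodule.span ℂ {globalState (V := V) false, globalState true},
      ∀ e, P e f = f := by
    intro f hf e
    obtain ⟨a, b, rfl⟩ := Submodule.mem_span_pair.mp hf
    simp only [P, map_add, map_smul, pairProj_globalState e.adj.ne]
  have hM := toTensor_secondMoment_circuitStep G hν
  constructor
  · ext Z
    rw [Module.End.mem_eigenspace_iff, one_smul, ← mem_span_globalState_iff,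
      ← (toTensor (V := V)).injective.eq_iff, hM]
    exact (average_apply_eq_self_iff hP _).trans
      ⟨fun h => hspan _ fun k _ => h (dart k), hfixed _⟩
  · have hD : (0 : ℝ) < Fintype.card G.Dart := by exact_mod_cast Fintype.card_pos
    have hD1 : (1 : ℝ) ≤ Fintype.card G.Dart := by exact_mod_cast Fintype.card_pos
    rw [spectralGap, le_sub_comm]
    -- The second goal, nonnegativity of the bound, covers an empty set of eigenvalues, whose
    -- supremum is 0.
    refine Real.sSup_le ?_ ?_
    · rintro _ ⟨z, hz, hz1, rfl⟩
      obtain ⟨Z, hZ⟩ := hz.exists_hasEigenvector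
      have hZ1 := hZ.apply_eq_smul
      refine norm_eigenvalue_le_of_chain (P := P) hP (N := n - 1) (c := dart) ?_ ?_ ?_
        (fun f hf => hfixed f (hspan f hf)) (x := toTensor Z)
        ((toTensor (V := V)).map_ne_zero_iff.mpr hZ.2) hz1 ?_
      · intro k hk l hl h
        have hk : k + 1 < n := by have := Finset.mem_range.mp hk; omega
        have hl : l + 1 < n := by have := Finset.mem_range.mp hl; omega
        rw [hdart k hk, hdart l hl] at h
        exact hinj k l (by omega) (by omega) (congrArg (fun e : G.Dart => e.fst) h)
      · intro k l hl hkl f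
        rw [hPdart k (by omega), hPdart l (by omega)]
        have h := LinearMap.congr_fun (pairProj_commute
          (hne k l (by omega) (by omega) (by omega))
          (hne k (l + 1) (by omega) (by omega) (by omega))
          (hne (k + 1) l (by omega) (by omega) (by omega))
          (hne (k + 1) (l + 1) (by omega) (by omega) (by omega))).eq f
        simpa only [Module.End.mul_apply] using h
      · intro k hk f
        rw [hPdart k (by omega), hPdart (k + 1) (by omega)]
        exact neg_le_two_mul_re_inner_pairProj 
          (hne k (k + 1) (by omega) (by omega) (by omega))
          (hne (k + 1) (k + 1 + 1) (by omega) (by omega) (by omega))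
          (hne k (k + 1 + 1) (by omega) (by omega) (by omega)) f
      · rw [← map_smul, ← hZ1, hM]
    · rw [sub_nonneg, div_le_one (by positivity)]
      linarith

end Gap

theorem mainTheorem8 (d : ℕ) :
    ∃ a : ℝ, 0 < a ∧ ∀ (L : Fin d → ℕ), 2 ≤ ∏ i, L i →
      ∀ (ν : Measure (Matrix.unitaryGroup (Fin 2 × Fin 2) ℂ)) [IsProbabilityMeasure ν],
        ν = haarGate ∨ ν = cliffordGate →
        (secondMoment (circuitStep (latticeBox L) ν)).eigenspace 1 =
            Submodule.span ℂ {1, swapOp (((i : Fin d) → Fin (L i)) → Fin 2)} ∧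
        a / (∏ i, (L i : ℝ)) ≤ spectralGap (secondMoment (circuitStep (latticeBox L) ν)) := by
  -- The factor 10 is 5 from the chain times 2 from `D ≤ 2 d n`; `d + 1` in place of `d` keeps the
  -- constant positive at `d = 0`, where no box has two sites.
  refine ⟨1 / (10 * (d + 1)), by positivity, fun L hL ν _ h => ?_⟩
  have hν : ∀ C ∈ cliffordGroup₂, ν.map (C * ·) = ν := by
    intro C hC
    rcases h with rfl | rfl
    · exact haarGate_map_mul C
    · exact cliffordGate_map_mul hC
  have hpos : ∀ i, 0 < L i := by
    intro i
    by_contra! h0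
    rw [Finset.prod_eq_zero (Finset.mem_univ i) (Nat.le_zero.mp h0)] at hL
    omega
  obtain ⟨c, hadj, hc⟩ := exists_path_through_latticeBox L hpos
  obtain ⟨h1, h2⟩ := eigenspace_and_gap_of_path (latticeBox L) hν hL (by simp) hadj hc
  refine ⟨h1, le_trans ?_ h2⟩
  have hD : (0 : ℝ) < Fintype.card (latticeBox L).Dart := by
    have : Nonempty (latticeBox L).Dart := ⟨⟨(c 0, c 1), hadj 0 (by omega)⟩⟩
    exact_mod_cast Fintype.card_pos
  have hle : (Fintype.card (latticeBox L).Dart : ℝ) ≤ 2 * d * ∏ i, (L i : ℝ) := by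
    exact_mod_cast card_dart_latticeBox_le L
  have hn : (0 : ℝ) < ∏ i, (L i : ℝ) := Finset.prod_pos fun i _ => by exact_mod_cast hpos i
  rw [div_div]
  refine one_div_le_one_div_of_le (by positivity) ?_
  nlinarith
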